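/- **Network.** A cloud network is a finite directed graph with node set $\mathcal V$ and link set $\mathcal E$, processing capacities $C_i\ge 0$ and unit costs $e_i\ge 0$ at the nodes, transmission capacities $C_{ij}\ge0$ and unit costs $e_{ij}\ge 0$ on the links. It offers a finite set of services; service $\phi$ has stages $1,\dots,M_\phi$, and its $m$-th function ($m<M_\phi$) turns stage $m$ data into stage $m+1$ data, with scaling factor $\xi_\phi^{(m)}\ge 0$ and workload $r_\phi^{(m)}>0$. Each service is requested by finitely many destination sets $\mathcal D\subset\mathcal V$. A commodity is a pair $(c,q)$ with $c=(\phi,m,\mathcal D)$ and a duplication status $\emptyset\ne q\subseteq\mathcal D$ (the set of current destinations). Exogenous arrivals $a(t)=\{a_i^{(c,q)}(t)\}\ge 0$ are i.i.d. over time slots (hence independent of the past), with means $\lambda=\{\lambda_i^{(c,q)}\}$ and finite second moments. **Operations.** When a packet of status $q$ is processed at a node or sent over a link, it may be split into an operated copy of status $s\neq\emptyset$ and a copy of status $r$ (possibly $\emptyset$, i.e. none) that is reloaded at the node, where $q\subseteq s\cup r$ (coverage); the operation is efficient if $q=s\sqcup r$. A packet of a final stage arriving (exogenously, by operation, or by reloading)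 at a destination $i\in q$ delivers its copy for $i$, and the rest, of status $q\setminus\{i\}$ (nothing, if this is empty), joins the queue of that status; so the queues with $m=M_\phi$, $i\in q$ are always empty. **Capacity region and optimal cost.** A decision assigns to each interface (the processing unit of a node, or a link) a nonnegative amount for every operation, subject to total workload $\le C_i$ at each node and total amount $\le C_{ij}$ on each link; its cost $h$ is $\sum_i e_i\cdot(\text{workload at }i)+\sum_{(i,j)}e_{ij}\cdot(\text{amount on }(i,j))$. A policy supports $\lambda$ if it makes such a decision in every slot, possibly with inefficient operations, and, for each queue, the long-term average flow joining it (operated copies, reloaded copies and $\lambda$) is at most the long-term average flow taken from it. $\Lambda$ is the set of all $\lambda$ supported by some policy, and $h^\star(\lambda)$ is the infimum of the long-term average costs of the policies supporting $\lambda$. **Max-weight policy** with parameter $V\ge0$. In slot $t$, with queue backlogs $Q(t)=\{Q_i^{(c,q)}(t)\}$, give every efficient operation $(c,q,s)$, $\emptyset\ne s\subseteq q$, the weight $$w_i^{(c,q,s)}=\frac{Q_i^{(c,q)}-\hat Q_i^{(c,q\setminus s)}-\xi_\phi^{(m)}\hat Q_i^{(c',s)}}{r_\phi^{(m)}}-Ve_i,\qquad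 w_{ij}^{(c,q,s)}=Q_i^{(c,q)}-\hat Q_i^{(c,q\setminus s)}-\hat Q_j^{(c,s)}-Ve_{ij},$$ for processing at $i$ (where $m<M_\phi$, $c'=(\phi,m+1,\mathcal D)$) and for transmission on $(i,j)$. Here $\hat Q_i^{(c,q)}$ is the backlog of the queue that a packet of commodity $(c,q)$ joins at $i$: it is $Q_i^{(c,q\setminus\{i\})}$ if $c$ is of a final stage and $i\in q$, and $Q_i^{(c,q)}$ otherwise, with $Q_i^{(c,\emptyset)}=0$. Each interface picks an operation of largest weight (ties broken arbitrarily); if this weight is positive, it performs that operation in the amount $C_i/r_\phi^{(m)}$, respectively $C_{ij}$, and it does nothing otherwise. The queues evolve by $Q(t+1)=[Q(t)-\text{requested outflow}]^++\text{inflow}+a(t)$, where the available packets that are requested are operated, and missing packets may be replaced, fully, partly or not at all, by dummy packets. The cost $h(t)$ is that of the decision at time $t$, and $Q(0)\ge 0$ has finite second moment and is independent of the arrivals. **Theorem.** For every network and every bound $A$ on the second moments of the arrivals there is a constant $B\ge 0$ (not depending on $\lambda$, $V$, $\epsilon$ or the initial state) such that for every $\lambda$ in the interior of $\Lambda$ and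 every $V\ge 0$, all $\mathbb E\|Q(t)\|_1$ and $\mathbb E\,h(t)$ are finite and $$\limsup_{T\to\infty}\frac1T\sum_{t=1}^T\mathbb E\|Q(t)\|_1\le\frac B\epsilon+\frac{h^\star(\lambda+\epsilon\mathbf 1)-h^\star(\lambda)}{\epsilon}\,V\quad\text{for each }\epsilon>0\text{ with }\lambda+\epsilon\mathbf 1\in\Lambda,$$ $$\limsup_{T\to\infty}\frac1T\sum_{t=1}^T\mathbb E\,h(t)\le h^\star(\lambda)+\frac BV\quad\text{if }V>0.$$ In particular $\limsup_{T\to\infty}\frac1T\sum_{t=1}^T\mathbb E\|Q(t)\|_1<\infty$ for every such $\lambda$ and $V$ (throughput optimality), and the two bounds are of order $O(V)$ and $O(1/V)$ in $V$. -/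

import Mathlib

open MeasureTheory ProbabilityTheory Filter Topology
open scoped BigOperators ENNReal

/-- A cloud network with node set `Node`, offering the services `Srv`, in slotted time. -/
structure CloudNetwork (Node Srv : Type*) [DecidableEq Node] where
  /-- the directed links `(i, j)` -/
  links : Finset (Node × Node)
  /-- `C_i`: processing capacity of node `i` -/
  procCap : Node → ℝ
  /-- `e_i`: cost of one unit of processing resource at node `i` -/
  procCost : Node → ℝ
  /-- `C_ij`: transmission capacity of link `(i, j)` -/
  linkCap : Node × Node → ℝ
  /-- `e_ij`: cost of transmitting one unit of data on link `(i, j)` -/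
  linkCost : Node × Node → ℝ
  /-- `M_φ`: the number of stages of service `φ`, which has `M_φ - 1` functions. Stages are
  numbered `0, ..., M_φ - 1`, and function `m` turns stage `m` data into stage `m + 1` data. -/
  stages : Srv → ℕ
  /-- `ξ_φ^(m)`: output size per unit of input of function `m` of service `φ` -/
  scale : Srv → ℕ → ℝ
  /-- `r_φ^(m)`: computing resource per unit of input of function `m` of service `φ` -/
  work : Srv → ℕ → ℝ
  /-- the destination sets that request service `φ` -/
  destSets : Srv → Finset (Finset Node)
  procCap_nonneg : ∀ i, 0 ≤ procCap i
  procCost_nonneg : ∀ i, 0 ≤ procCost i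
  linkCap_nonneg : ∀ e ∈ links, 0 ≤ linkCap e
  linkCost_nonneg : ∀ e ∈ links, 0 ≤ linkCost e
  scale_nonneg : ∀ φ m, m + 1 < stages φ → 0 ≤ scale φ m
  work_pos : ∀ φ m, m + 1 < stages φ → 0 < work φ m

namespace CloudNetwork

section Basic

variable {Node Srv : Type*} [DecidableEq Node] (N : CloudNetwork Node Srv)

/-- The triples `c = (φ, m, 𝒟)`: service, stage, destination set. -/
abbrev Stream : Type _ :=
  Σ φ : Srv, Fin (N.stages φ) × {D : Finset Node // D ∈ N.destSets φ}

variable {N} in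
/-- The destination set `𝒟` of `c = (φ, m, 𝒟)`. -/
abbrev Stream.dest (c : N.Stream) : Finset Node := c.2.2.1

variable {N} in
/-- The stage `m` of `c = (φ, m, 𝒟)`. -/
abbrev Stream.stage (c : N.Stream) : ℕ := c.2.1.1

variable {N} in
/-- All functions of the service have been applied. -/
abbrev Stream.IsFinal (c : N.Stream) : Prop := c.stage + 1 = N.stages c.1

/-- The commodities `(c, q)`. The duplication status `q` is represented by the set of current
destinations, a nonempty subset of `𝒟` (the status `0` is not of interest). -/
abbrev Commodity : Type _ :=
  Σ c : N.Stream, {q : Finset Node // q.Nonempty ∧ q ⊆ c.dest}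

/-- Vectors with one entry for each node and commodity (arrivals, arrival rates, backlogs). -/
abbrev Vec : Type _ := Node → N.Commodity → ℝ

/-- The ways `(c; q, s, r)` of operating (processing or transmitting) a packet of commodity
`(c, q)`: the copy with status `s` is operated on, the copy with status `r` is reloaded to the
queueing system of the node (none is, if `r` is empty). Coverage: each destination of the
original packet is a destination of at least one copy. -/
abbrev Op : Type _ :=
  Σ c : N.Stream, {o : Finset Node × Finset Node × Finset Node //
    (o.1.Nonempty ∧ o.1 ⊆ c.dest) ∧ (o.2.1.Nonempty ∧ o.2.1 ⊆ c.dest) ∧ o.2.2 ⊆ c.dest ∧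
      o.1 ⊆ o.2.1 ∪ o.2.2}

variable {N} in
/-- The status `q` of the original packet. -/
abbrev Op.orig (o : N.Op) : Finset Node := o.2.1.1

variable {N} in
/-- The status `s` of the copy that is operated on. -/
abbrev Op.copy (o : N.Op) : Finset Node := o.2.1.2.1

variable {N} in
/-- The status `r` of the copy that is reloaded. -/
abbrev Op.reload (o : N.Op) : Finset Node := o.2.1.2.2

variable {N} in
/-- Efficient duplication, `q = s + r` as indicator vectors. -/
def Op.Efficient (o : N.Op) : Prop := Disjoint o.copy o.reload ∧ o.orig = o.copy ∪ o.reload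

/-- The operations available for processing: there is a function left to apply. -/
abbrev ProcOp : Type _ := {o : N.Op // o.1.stage + 1 < N.stages o.1.1}

variable {N} in
/-- The stream `(φ, m + 1, 𝒟)` of the processed copy. -/
abbrev ProcOp.out (o : N.ProcOp) : N.Stream := ⟨o.1.1.1, ⟨o.1.1.stage + 1, o.2⟩, o.1.1.2.2⟩

variable {N} in
/-- The scaling factor of the function that is applied. -/
abbrev ProcOp.scale (o : N.ProcOp) : ℝ := N.scale o.1.1.1 o.1.1.stage

variable {N} in
/-- The workload of the function that is applied. -/
abbrev ProcOp.work (o : N.ProcOp) : ℝ := N.work o.1.1.1 o.1.1.stage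

/-- The decisions in one time slot: amounts of packets to be operated in each way at the
processing interface of each node, and on each link. -/
structure Decision where
  proc : Node → N.ProcOp → ℝ
  trans : {e : Node × Node // e ∈ N.links} → N.Op → ℝ

/-- The set of destinations that a packet of commodity `k` still has when it joins a queue of
node `i`. A packet of the final stage that reaches one of its destinations `i` is duplicated: the
copy for `i` leaves the network, the other copy joins the queue of the remaining destinations
(and there is none, if no destination remains). -/
def residual (i : Node) (k : N.Commodity) : Finset Node :=
  if k.1.IsFinal then k.2.1.erase i else k.2.1

/-- The queues of destination state: they are always empty. -/
def Consumed (i : Node) (k : N.Commodity) : Prop := k.1.IsFinal ∧ i ∈ k.2.1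

/-- The backlog of the queue with the destinations `q`, which is `0` for no destination. -/
def backlog (Q : N.Vec) (i : Node) (c : N.Stream) (q : Finset Node) : ℝ :=
  if h : q.Nonempty ∧ q ⊆ c.dest then Q i ⟨c, q, h⟩ else 0

/-- The backlog of the queue that a packet of stream `c` with destinations `q` joins at node `i`.
This is the queue of `(c, q)`, except at destination states. -/
def joinedBacklog (Q : N.Vec) (i : Node) (c : N.Stream) (q : Finset Node) : ℝ :=
  N.backlog Q i c (if c.IsFinal then q.erase i else q)

/-- The max-weight weight of a processing operation at node `i`. -/
noncomputable def procWeight (V : ℝ) (Q : N.Vec) (i : Node) (o : N.ProcOp) : ℝ :=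
  (N.backlog Q i o.1.1 o.1.orig - N.joinedBacklog Q i o.1.1 o.1.reload
    - o.scale * N.joinedBacklog Q i o.out o.1.copy) / o.work - V * N.procCost i

/-- The max-weight weight of a transmission operation on the link `e = (i, j)`. -/
def linkWeight (V : ℝ) (Q : N.Vec) (e : Node × Node) (o : N.Op) : ℝ :=
  N.backlog Q e.1 o.1 o.orig - N.joinedBacklog Q e.1 o.1 o.reload
    - N.joinedBacklog Q e.2 o.1 o.copy - V * N.linkCost e

/-- The max-weight rule at one interface: `x` serves one of the admitted operations of largest
weight, in the amount `full` if this weight is positive, and nothing else. -/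
def MaxWeightRule {ι : Type*} (admitted : ι → Prop) (w full x : ι → ℝ) : Prop :=
  ((∀ o, ¬ admitted o) ∧ ∀ o, x o = 0) ∨
  ∃ o, admitted o ∧ (∀ o', admitted o' → w o' ≤ w o) ∧
    (0 < w o → x o = full o) ∧ (¬ 0 < w o → x o = 0) ∧ ∀ o', o' ≠ o → x o' = 0

/-- `x` is a decision of the max-weight policy with parameter `V` for the backlogs `Q`.
Ties are broken arbitrarily. -/
def IsMaxWeight (V : ℝ) (Q : N.Vec) (x : N.Decision) : Prop :=
  (∀ i, MaxWeightRule (fun o : N.ProcOp => o.1.Efficient) (N.procWeight V Q i)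
    (fun o => N.procCap i / o.work) (x.proc i)) ∧
  ∀ e, MaxWeightRule (fun o : N.Op => o.Efficient) (N.linkWeight V Q e.1)
    (fun _ => N.linkCap e.1) (x.trans e)

end Basic

section Flows

variable {Node Srv : Type*} [Fintype Node] [DecidableEq Node] [Fintype Srv] [DecidableEq Srv]
  (N : CloudNetwork Node Srv)

/-- Amount of commodity `k` that is taken from its queue at node `i`. -/
def outflow (x : N.Decision) (i : Node) (k : N.Commodity) : ℝ :=
  (∑ o : N.ProcOp, if o.1.1 = k.1 ∧ o.1.orig = k.2.1 then x.proc i o else 0) +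
  ∑ e : {e : Node × Node // e ∈ N.links}, if e.1.1 = i then
    (∑ o : N.Op, if o.1 = k.1 ∧ o.orig = k.2.1 then x.trans e o else 0) else 0

/-- Amount of commodity `k` that node `i` gets from its own processing unit and from its incoming
links. -/
def delivered (x : N.Decision) (i : Node) (k : N.Commodity) : ℝ :=
  (∑ o : N.ProcOp, if o.out = k.1 ∧ o.1.copy = k.2.1 then o.scale * x.proc i o else 0) +
  ∑ e : {e : Node × Node // e ∈ N.links}, if e.1.2 = i then
    (∑ o : N.Op, if o.1 = k.1 ∧ o.copy = k.2.1 then x.trans e o else 0) else 0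

/-- Amount of commodity `k` that is reloaded at node `i` after duplication. -/
def reloaded (x : N.Decision) (i : Node) (k : N.Commodity) : ℝ :=
  (∑ o : N.ProcOp, if o.1.1 = k.1 ∧ o.1.reload = k.2.1 then x.proc i o else 0) +
  ∑ e : {e : Node × Node // e ∈ N.links}, if e.1.1 = i then
    (∑ o : N.Op, if o.1 = k.1 ∧ o.reload = k.2.1 then x.trans e o else 0) else 0

/-- The controllable incoming flow. -/
def inflow (x : N.Decision) (i : Node) (k : N.Commodity) : ℝ :=
  N.delivered x i k + N.reloaded x i k

/-- If `A` are the amounts that come in at the nodes, `joins A i k` is the amount that joins the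
queue of commodity `k` at node `i`. This is `A i k`, except that for the final stage and a
destination `i` it is `0` if `i` is in the status `q` of `k`, and otherwise the sum of what comes
in with the statuses `q` and `q ∪ {i}`. -/
def joins (A : N.Vec) (i : Node) (k : N.Commodity) : ℝ :=
  ∑ k' : N.Commodity, if k'.1 = k.1 ∧ N.residual i k' = k.2.1 then A i k' else 0

/-- The cost `h` of the allocated resources in one time slot. -/
def cost (x : N.Decision) : ℝ :=
  (∑ i, N.procCost i * ∑ o : N.ProcOp, o.work * x.proc i o) +
  ∑ e : {e : Node × Node // e ∈ N.links}, N.linkCost e.1 * ∑ o : N.Op, x.trans e o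

/-- The total backlog `‖Q‖₁`. -/
def totalBacklog (Q : N.Vec) : ℝ := ∑ i, ∑ k, |Q i k|

/-- Non-negativity and capacity constraints. -/
structure Feasible (x : N.Decision) : Prop where
  proc_nonneg : ∀ i o, 0 ≤ x.proc i o
  trans_nonneg : ∀ e o, 0 ≤ x.trans e o
  proc_cap : ∀ i, ∑ o : N.ProcOp, o.work * x.proc i o ≤ N.procCap i
  trans_cap : ∀ e : {e : Node × Node // e ∈ N.links}, ∑ o : N.Op, x.trans e o ≤ N.linkCap e.1

/-- The time average `(1 / T) ∑ t = 1, ..., T` of a sequence. -/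
noncomputable def timeAvg (z : ℕ → ℝ) (T : ℕ) : ℝ := (1 / (T : ℝ)) * ∑ t ∈ Finset.Icc 1 T, z t

/-- The long-term average of `z` exists and equals `l`. -/
def HasAvg (z : ℕ → ℝ) (l : ℝ) : Prop := Tendsto (timeAvg z) atTop (𝓝 l)

/-- The long-term average of `z` in the sense of the upper limit, as an extended real number. -/
noncomputable def upperAvg (z : ℕ → ℝ) : EReal :=
  limsup (fun T => ((timeAvg z T : ℝ) : EReal)) atTop

/-- `f` is a policy of the general policy space that supports the arrival rates `lam`: all
duplications with coverage are allowed, the decisions are feasible in each slot, and for each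
queue the average flow joining it, arrivals included, is at most the average flow taken from
it. -/
def Admissible (lam : N.Vec) (f : ℕ → N.Decision) : Prop :=
  (∀ t, N.Feasible (f t)) ∧
  ∃ fin fout : N.Vec,
    (∀ i k, HasAvg (fun t => N.inflow (f t) i k) (fin i k)) ∧
    (∀ i k, HasAvg (fun t => N.outflow (f t) i k) (fout i k)) ∧
    ∀ i k, ¬ N.Consumed i k → N.joins (fun j l => fin j l + lam j l) i k ≤ fout i k

/-- The capacity region `Λ`. Sign conditions on the entries of `lam` are left to the arrival
process, so that rate vectors with some zero entries can lie in the interior. -/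
def capacityRegion : Set N.Vec := {lam | ∃ f, N.Admissible lam f}

/-- The optimal cost `h⋆(lam)`: the infimum of the long-term average costs of the policies of the
general policy space that support `lam`. -/
noncomputable def optCost (lam : N.Vec) : ℝ :=
  sInf {h | ∃ f, N.Admissible lam f ∧ HasAvg (fun t => N.cost (f t)) h}

/-- `a` is an arrival process with rate vector `lam`: `a t` is known at time `t + 1`, it is
independent of the past `ℱ t`, the distribution does not depend on `t`, the second moments are
finite. In particular the `a t` are i.i.d. -/
structure IsIIDArrivals {Ω : Type*} [m : MeasurableSpace Ω] (P : Measure Ω)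
    (ℱ : Filtration ℕ m) (a : ℕ → Ω → N.Vec) (lam : N.Vec) : Prop where
  adapted : ∀ t, Measurable[ℱ (t + 1)] (a t)
  indep_past : ∀ t, Indep (MeasurableSpace.comap (a t) inferInstance) (ℱ t) P
  identDistrib : ∀ t, IdentDistrib (a t) (a 0) P P
  nonneg : ∀ t ω i k, 0 ≤ a t ω i k
  memLp_two : ∀ t i k, MemLp (fun ω => a t ω i k) 2 P
  mean : ∀ t i k, ∫ ω, a t ω i k ∂P = lam i k

/-- The backlogs `Q`, with arrivals `a`, evolve under the max-weight policy with parameter `V`.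
Here `x t` are the decisions, and `y t` are the amounts that are actually operated: all available
packets that the decisions ask for, and possibly dummy packets that make up for (a part of) the
lack of available packets. -/
structure IsMaxWeightRun {Ω : Type*} [m : MeasurableSpace Ω] (P : Measure Ω)
    (ℱ : Filtration ℕ m) (a : ℕ → Ω → N.Vec) (V : ℝ) (Q : ℕ → Ω → N.Vec)
    (x y : ℕ → Ω → N.Decision) : Prop where
  adapted : ∀ t, Measurable[ℱ t] (Q t)
  init_memLp_two : ∀ i k, MemLp (fun ω => Q 0 ω i k) 2 P
  init_nonneg : ∀ ω i k, 0 ≤ Q 0 ω i k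
  meas_x_proc : ∀ t i o, Measurable fun ω => (x t ω).proc i o
  meas_x_trans : ∀ t e o, Measurable fun ω => (x t ω).trans e o
  meas_y_proc : ∀ t i o, Measurable fun ω => (y t ω).proc i o
  meas_y_trans : ∀ t e o, Measurable fun ω => (y t ω).trans e o
  /-- the decisions are those of the max-weight policy -/
  maxWeight : ∀ t ω, N.IsMaxWeight V (Q t ω) (x t ω)
  y_proc : ∀ t ω i o, 0 ≤ (y t ω).proc i o ∧ (y t ω).proc i o ≤ (x t ω).proc i o
  y_trans : ∀ t ω e o, 0 ≤ (y t ω).trans e o ∧ (y t ω).trans e o ≤ (x t ω).trans e o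
  served : ∀ t ω i k, min (Q t ω i k) (N.outflow (x t ω) i k) ≤ N.outflow (y t ω) i k
  /-- queues of destination state are empty -/
  consumed : ∀ t ω i k, N.Consumed i k → Q t ω i k = 0
  /-- the queueing dynamics -/
  step : ∀ t ω i k, ¬ N.Consumed i k →
    Q (t + 1) ω i k = max (Q t ω i k - N.outflow (x t ω) i k) 0
      + N.joins (fun j l => N.inflow (y t ω) j l + a t ω j l) i k

end Flows

end CloudNetwork

/-!
Why the bounds hold. The proof is a drift-plus-penalty argument with the Lyapunov function
`‖Q‖₂²`.

*Max-weight against all decisions* (`IsMaxWeight.drift_ge`). By `sum_weight`, the total weight of a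
decision is its drift on the backlogs minus `V` times its cost, and the max-weight decision
maximizes it over efficient decisions. The capacity region and the optimal cost, however, refer to
policies that may duplicate inefficiently. Instead of turning such a policy into an efficient one,
the queues are repriced: the price `maxSubBacklog Q` of a packet of status `q` is the largest
backlog among the statuses `p ⊆ q`. If `p` attains the price of the original packet of an operation
`(q; s, r)`, then the efficient operation `(p; p ∩ s, p \ s)` earns at least as much at the prices
`Q` as `(q; s, r)` earns at the new prices, since `p ∩ s ⊆ s` and `p \ s ⊆ r`; and if `p ∩ s = ∅`
then `p ⊆ r`, and `(q; s, r)` earns nothing. As the new prices dominate `Q`, and the net outflow of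
a decision supporting rates `mu` dominates the nonnegative rates, the max-weight value is at least
`∑ Q * joins mu` minus `V` times the cost of that decision.

*Drift.* The arrivals of a slot are independent of the backlogs, so that taking expectations gives
`exists_drift_bound`, for every stationary decision `z` that supports `lam + ε`, with a constant `B`
that comes from the capacities and the second moments of the arrivals only.

*Stationary decisions suffice.* The feasible decisions form a compact set, so the time averages of
a policy have a limit point, which supports the same rates at the same cost
(`Admissible.exists_supports`). Hence the optimal cost is the infimum of the costs of supporting
stationary decisions.

*Conclusion.* Averaging the drift bound over time with `ε = 0` bounds the average cost, and shows
that `E ‖Q(t)‖₂²` grows at most linearly. So the backlogs are mean rate stable, whence every limit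
point of the averages of the expected operated amounts supports `lam`, and the average cost is
eventually at least `h⋆(lam) - δ` (`IsMaxWeightRun.eventually_optCost_le`). Inserting this into the
averaged drift bound with `ε > 0` bounds the average backlog.
-/

namespace CloudNetwork

variable {Node Srv : Type*} [DecidableEq Node] {N : CloudNetwork Node Srv}

/-! ### Backlogs -/

@[simp]
theorem backlog_empty (U : N.Vec) (i : Node) (c : N.Stream) : N.backlog U i c ∅ = 0 := by
  simp [backlog]

@[simp]
theorem joinedBacklog_empty (U : N.Vec) (i : Node) (c : N.Stream) :
    N.joinedBacklog U i c ∅ = 0 := by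
  simp [joinedBacklog]

theorem backlog_joinedBacklog (U : N.Vec) (i : Node) (c : N.Stream) {q : Finset Node}
    (hq : q ⊆ c.dest) :
    N.backlog (fun i k => N.joinedBacklog U i k.1 k.2.1) i c q = N.joinedBacklog U i c q := by
  rw [backlog]
  split_ifs with h
  · rfl
  · have : q = ∅ := Finset.not_nonempty_iff_eq_empty.1 fun hn => h ⟨hn, hq⟩
    simp [this]

/-! ### Linear forms with nonnegative coefficients on decisions -/

/-- `F` is a linear form in the entries of a decision, with nonnegative coefficients. An inductive
presentation is used because all facts needed about such forms follow by induction. -/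
inductive NonnegForm (N : CloudNetwork Node Srv) : (N.Decision → ℝ) → Prop
  | zero : NonnegForm N fun _ => 0
  | proc (i : Node) (o : N.ProcOp) : NonnegForm N fun x => x.proc i o
  | trans (e : {e : Node × Node // e ∈ N.links}) (o : N.Op) : NonnegForm N fun x => x.trans e o
  | add {F G : N.Decision → ℝ} : NonnegForm N F → NonnegForm N G → NonnegForm N fun x => F x + G x
  | smul {F : N.Decision → ℝ} (c : ℝ) : 0 ≤ c → NonnegForm N F → NonnegForm N fun x => c * F x

namespace NonnegForm

theorem sum {ι : Type*} (s : Finset ι) {F : ι → N.Decision → ℝ} (h : ∀ j, NonnegForm N (F j)) :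
    NonnegForm N fun x => ∑ j ∈ s, F j x := by
  classical
  induction s using Finset.induction_on with
  | empty => simpa using NonnegForm.zero
  | insert j s hj ih => simpa [Finset.sum_insert hj] using (h j).add ih

theorem ite (p : Prop) [Decidable p] {F : N.Decision → ℝ} (h : NonnegForm N F) :
    NonnegForm N fun x => if p then F x else 0 := by
  by_cases hp : p
  · simpa [hp] using h
  · simpa [hp] using NonnegForm.zero

variable {F : N.Decision → ℝ}

theorem mono (hF : NonnegForm N F) {x y : N.Decision} (hp : ∀ i o, x.proc i o ≤ y.proc i o)
    (ht : ∀ e o, x.trans e o ≤ y.trans e o) : F x ≤ F y := by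
  induction hF with
  | zero => exact le_rfl
  | proc i o => exact hp i o
  | trans e o => exact ht e o
  | add _ _ h1 h2 => exact add_le_add h1 h2
  | smul c hc _ h => exact mul_le_mul_of_nonneg_left h hc

theorem nonneg (hF : NonnegForm N F) {x : N.Decision} (hp : ∀ i o, 0 ≤ x.proc i o)
    (ht : ∀ e o, 0 ≤ x.trans e o) : 0 ≤ F x := by
  induction hF with
  | zero => exact le_rfl
  | proc i o => exact hp i o
  | trans e o => exact ht e o
  | add _ _ h1 h2 => exact add_nonneg h1 h2
  | smul c hc _ h => exact mul_nonneg hc h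

theorem tendsto (hF : NonnegForm N F) {d : ℕ → N.Decision} {z : N.Decision}
    (hp : ∀ i o, Tendsto (fun n => (d n).proc i o) atTop (𝓝 (z.proc i o)))
    (ht : ∀ e o, Tendsto (fun n => (d n).trans e o) atTop (𝓝 (z.trans e o))) :
    Tendsto (fun n => F (d n)) atTop (𝓝 (F z)) := by
  induction hF with
  | zero => exact tendsto_const_nhds
  | proc i o => exact hp i o
  | trans e o => exact ht e o
  | add _ _ h1 h2 => exact h1.add h2
  | smul c _ _ h => exact h.const_mul c

end NonnegForm

/-! ### Boundedness of feasible decisions -/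

variable [Fintype Node] [Fintype Srv]

theorem Feasible.proc_le {x : N.Decision} (hx : N.Feasible x) (i : Node)
    (o : N.ProcOp) : x.proc i o ≤ N.procCap i / o.work := by
  have hw : ∀ o : N.ProcOp, 0 < o.work := fun o => N.work_pos _ _ o.2
  rw [le_div_iff₀ (hw o), mul_comm]
  exact (Finset.single_le_sum (f := fun o : N.ProcOp => o.work * x.proc i o)
    (fun o _ => mul_nonneg (hw o).le (hx.proc_nonneg i o)) (Finset.mem_univ o)).trans
    (hx.proc_cap i)

theorem Feasible.trans_le {x : N.Decision} (hx : N.Feasible x)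
    (e : {e : Node × Node // e ∈ N.links}) (o : N.Op) : x.trans e o ≤ N.linkCap e.1 :=
  (Finset.single_le_sum (fun o _ => hx.trans_nonneg e o) (Finset.mem_univ o)).trans
    (hx.trans_cap e)

theorem NonnegForm.exists_bound {F : N.Decision → ℝ} (hF : NonnegForm N F) :
    ∃ K, 0 ≤ K ∧ ∀ x, N.Feasible x → F x ≤ K := by
  induction hF with
  | zero => exact ⟨0, le_rfl, fun _ _ => le_rfl⟩
  | proc i o =>
    exact ⟨N.procCap i / o.work, div_nonneg (N.procCap_nonneg i) (N.work_pos _ _ o.2).le,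
      fun x hx => hx.proc_le i o⟩
  | trans e o => exact ⟨N.linkCap e.1, N.linkCap_nonneg e.1 e.2, fun x hx => hx.trans_le e o⟩
  | add _ _ h1 h2 =>
    obtain ⟨K, hK, h⟩ := h1
    obtain ⟨K', hK', h'⟩ := h2
    exact ⟨K + K', add_nonneg hK hK', fun x hx => add_le_add (h x hx) (h' x hx)⟩
  | smul c hc _ h =>
    obtain ⟨K, hK, h⟩ := h
    exact ⟨c * K, mul_nonneg hc hK, fun x hx => mul_le_mul_of_nonneg_left (h x hx) hc⟩

theorem Feasible.nonneg_of_form {F : N.Decision → ℝ} (hF : NonnegForm N F) {x : N.Decision}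
    (hx : N.Feasible x) : 0 ≤ F x :=
  hF.nonneg hx.proc_nonneg hx.trans_nonneg

theorem nonnegForm_work (i : Node) :
    NonnegForm N fun x => ∑ o : N.ProcOp, o.work * x.proc i o :=
  .sum _ fun o => .smul _ (N.work_pos _ _ o.2).le (.proc i o)

theorem nonnegForm_load (e : {e : Node × Node // e ∈ N.links}) :
    NonnegForm N fun x => ∑ o : N.Op, x.trans e o :=
  .sum _ fun o => .trans e o

theorem nonnegForm_cost : NonnegForm N fun x => N.cost x :=
  (NonnegForm.sum _ fun i => .smul _ (N.procCost_nonneg i) (nonnegForm_work i)).add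
    (NonnegForm.sum _ fun e => .smul _ (N.linkCost_nonneg e.1 e.2) (nonnegForm_load e))

variable [DecidableEq Srv]

theorem nonnegForm_outflow (i : Node) (k : N.Commodity) :
    NonnegForm N fun x => N.outflow x i k :=
  (NonnegForm.sum _ fun o => .ite _ (.proc i o)).add
    (NonnegForm.sum _ fun e => .ite _ (.sum _ fun o => .ite _ (.trans e o)))

theorem nonnegForm_inflow (i : Node) (k : N.Commodity) :
    NonnegForm N fun x => N.inflow x i k :=
  ((NonnegForm.sum _ fun o =>
      .ite _ (.smul o.scale (N.scale_nonneg _ _ o.2) (.proc i o))).add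
    (NonnegForm.sum _ fun e => .ite _ (.sum _ fun o => .ite _ (.trans e o)))).add
  ((NonnegForm.sum _ fun o => .ite _ (.proc i o)).add
    (NonnegForm.sum _ fun e => .ite _ (.sum _ fun o => .ite _ (.trans e o))))

theorem nonnegForm_joins_inflow (i : Node) (k : N.Commodity) :
    NonnegForm N fun x => N.joins (N.inflow x) i k :=
  NonnegForm.sum _ fun k' => .ite _ (nonnegForm_inflow i k')

/-! ### Flow joining the queues -/

theorem joins_add (A B : N.Vec) (i : Node) (k : N.Commodity) :
    N.joins (fun j l => A j l + B j l) i k = N.joins A i k + N.joins B i k := by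
  simp only [joins, ← Finset.sum_add_distrib]
  refine Finset.sum_congr rfl fun k' _ => ?_
  split_ifs <;> simp

theorem joins_mono {A B : N.Vec} {i : Node} (h : ∀ k, A i k ≤ B i k) (k : N.Commodity) :
    N.joins A i k ≤ N.joins B i k := by
  refine Finset.sum_le_sum fun k' _ => ?_
  split_ifs
  exacts [h k', le_rfl]

theorem joins_nonneg {A : N.Vec} {i : Node} (h : ∀ k, 0 ≤ A i k) (k : N.Commodity) :
    0 ≤ N.joins A i k := by
  refine Finset.sum_nonneg fun k' _ => ?_
  split_ifs
  exacts [h k', le_rfl]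

theorem le_joins {A : N.Vec} {i : Node} (h : ∀ k, 0 ≤ A i k) {k : N.Commodity}
    (hk : ¬ N.Consumed i k) : A i k ≤ N.joins A i k := by
  have hres : N.residual i k = k.2.1 := by
    unfold residual
    split_ifs with hf
    · exact Finset.erase_eq_of_notMem fun hi => hk ⟨hf, hi⟩
    · rfl
  refine le_of_eq_of_le ?_ (Finset.single_le_sum (f := fun k' : N.Commodity =>
    if k'.1 = k.1 ∧ N.residual i k' = k.2.1 then A i k' else 0) (fun k' _ => ?_)
    (Finset.mem_univ k))
  · simp [hres]
  · split_ifs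
    exacts [h k', le_rfl]

theorem joins_consumed (A : N.Vec) {i : Node} {k : N.Commodity} (hk : N.Consumed i k) :
    N.joins A i k = 0 := by
  refine Finset.sum_eq_zero fun k' _ => if_neg ?_
  rintro ⟨h1, h2⟩
  have hf : k'.1.IsFinal := h1 ▸ hk.1
  rw [residual, if_pos hf] at h2
  exact Finset.notMem_erase i _ (h2 ▸ hk.2)

theorem joins_sq_le (A : N.Vec) (i : Node) (k : N.Commodity) :
    N.joins A i k ^ 2 ≤ Fintype.card N.Commodity * ∑ k', A i k' ^ 2 := by
  refine (sq_sum_le_card_mul_sum_sq (s := Finset.univ)).trans ?_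
  rw [Finset.card_univ]
  refine mul_le_mul_of_nonneg_left (Finset.sum_le_sum fun k' _ => ?_) (Nat.cast_nonneg _)
  split_ifs
  · exact le_rfl
  · rw [zero_pow two_ne_zero]
    exact sq_nonneg (A i k')

/-! ### The max-weight objective -/

/-- Summing over commodities against the indicator of `(c, q)` picks out the entry of `(c, q)`. -/
theorem sum_commodity_ite (F : N.Commodity → ℝ) (c : N.Stream) (q : Finset Node) (v : ℝ) :
    (∑ k : N.Commodity, F k * if c = k.1 ∧ q = k.2.1 then v else 0) =
      v * if h : q.Nonempty ∧ q ⊆ c.dest then F ⟨c, q, h⟩ else 0 := by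
  split_ifs with h
  · rw [Finset.sum_eq_single (⟨c, q, h⟩ : N.Commodity)]
    · simp [mul_comm]
    · rintro ⟨c', q', h'⟩ _ hne
      rw [if_neg, mul_zero]
      rintro ⟨rfl, rfl⟩
      exact hne rfl
    · simp
  · rw [mul_zero]
    refine Finset.sum_eq_zero fun k _ => ?_
    rw [if_neg, mul_zero]
    rintro ⟨rfl, rfl⟩
    exact h k.2.2

theorem sum_mul_joins (U A : N.Vec) (i : Node) :
    ∑ k, U i k * N.joins A i k = ∑ k, N.joinedBacklog U i k.1 k.2.1 * A i k := by
  simp only [joins, Finset.mul_sum]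
  rw [Finset.sum_comm]
  refine Finset.sum_congr rfl fun k _ => ?_
  rw [sum_commodity_ite (U i) k.1 (N.residual i k) (A i k), mul_comm]
  rfl

/-- Weighted sum of a flow whose amounts `p i o` (at the nodes) and `l e o` (on the links, charged
to the end `n e`) are attributed to the commodities `(c, q)` given by `cp, qp` and `cl, ql`. -/
theorem sum_attributed {ιp ιl ε : Type*} [Fintype ιp] [Fintype ιl] [Fintype ε]
    (F : N.Vec) (cp : ιp → N.Stream) (qp : ιp → Finset Node) (cl : ιl → N.Stream)
    (ql : ιl → Finset Node) (n : ε → Node) (p : Node → ιp → ℝ) (l : ε → ιl → ℝ) :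
    (∑ i, ∑ k, F i k * ((∑ o, if cp o = k.1 ∧ qp o = k.2.1 then p i o else 0) +
      ∑ e, if n e = i then (∑ o, if cl o = k.1 ∧ ql o = k.2.1 then l e o else 0) else 0)) =
    (∑ i, ∑ o, p i o * N.backlog F i (cp o) (qp o)) +
      ∑ e, ∑ o, l e o * N.backlog F (n e) (cl o) (ql o) := by
  simp only [mul_add, Finset.sum_add_distrib]
  congr 1
  · refine Finset.sum_congr rfl fun i _ => ?_
    simp only [Finset.mul_sum]
    rw [Finset.sum_comm]
    exact Finset.sum_congr rfl fun o _ => sum_commodity_ite (F i) _ _ _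
  · have h1 : ∀ i, (∑ k : N.Commodity, F i k * ∑ e, if n e = i then
        (∑ o, if cl o = k.1 ∧ ql o = k.2.1 then l e o else 0) else 0) =
        ∑ e, if n e = i then ∑ o, l e o * N.backlog F (n e) (cl o) (ql o) else 0 := by
      intro i
      simp only [Finset.mul_sum]
      rw [Finset.sum_comm]
      refine Finset.sum_congr rfl fun e _ => ?_
      split_ifs with he
      · subst he
        simp only [Finset.mul_sum]
        rw [Finset.sum_comm]
        exact Finset.sum_congr rfl fun o _ => sum_commodity_ite (F (n e)) _ _ _
      · simp
    simp only [h1]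
    rw [Finset.sum_comm]
    simp

theorem sum_mul_outflow (U : N.Vec) (x : N.Decision) :
    ∑ i, ∑ k, U i k * N.outflow x i k =
      (∑ i, ∑ o : N.ProcOp, x.proc i o * N.backlog U i o.1.1 o.1.orig) +
        ∑ e : {e : Node × Node // e ∈ N.links}, ∑ o : N.Op,
          x.trans e o * N.backlog U e.1.1 o.1 o.orig :=
  sum_attributed U (fun o : N.ProcOp => o.1.1) (fun o => o.1.orig) (fun o : N.Op => o.1)
    (fun o => o.orig) (fun e : {e : Node × Node // e ∈ N.links} => e.1.1) x.proc x.trans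

theorem sum_mul_joins_inflow (U : N.Vec) (x : N.Decision) :
    ∑ i, ∑ k, U i k * N.joins (N.inflow x) i k =
      (∑ i, ∑ o : N.ProcOp, x.proc i o * (o.scale * N.joinedBacklog U i o.out o.1.copy +
        N.joinedBacklog U i o.1.1 o.1.reload)) +
        ∑ e : {e : Node × Node // e ∈ N.links}, ∑ o : N.Op,
          x.trans e o * (N.joinedBacklog U e.1.2 o.1 o.copy +
            N.joinedBacklog U e.1.1 o.1 o.reload) := by
  simp only [sum_mul_joins]
  have hd := sum_attributed (fun i k => N.joinedBacklog U i k.1 k.2.1)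
    (fun o : N.ProcOp => o.out) (fun o => o.1.copy) (fun o : N.Op => o.1)
    (fun o => o.copy) (fun e : {e : Node × Node // e ∈ N.links} => e.1.2)
    (fun i o => o.scale * x.proc i o) x.trans
  have hr := sum_attributed (fun i k => N.joinedBacklog U i k.1 k.2.1)
    (fun o : N.ProcOp => o.1.1) (fun o => o.1.reload) (fun o : N.Op => o.1)
    (fun o => o.reload) (fun e : {e : Node × Node // e ∈ N.links} => e.1.1) x.proc x.trans
  have hsplit : (∑ i, ∑ k : N.Commodity, N.joinedBacklog U i k.1 k.2.1 * N.inflow x i k) =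
      (∑ i, ∑ k : N.Commodity, N.joinedBacklog U i k.1 k.2.1 * N.delivered x i k) +
      ∑ i, ∑ k : N.Commodity, N.joinedBacklog U i k.1 k.2.1 * N.reloaded x i k := by
    simp only [inflow, mul_add, Finset.sum_add_distrib]
  rw [hsplit]
  unfold delivered reloaded
  rw [hd, hr]
  simp only [mul_add, Finset.sum_add_distrib]
  have e1 : ∀ i (o : N.ProcOp), N.backlog (fun i k => N.joinedBacklog U i k.1 k.2.1) i o.out
      o.1.copy = N.joinedBacklog U i o.out o.1.copy :=
    fun i o => backlog_joinedBacklog U i o.out o.1.2.2.2.1.2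
  have e2 : ∀ i (o : N.Op), N.backlog (fun i k => N.joinedBacklog U i k.1 k.2.1) i o.1
      o.reload = N.joinedBacklog U i o.1 o.reload :=
    fun i o => backlog_joinedBacklog U i o.1 o.2.2.2.2.1
  have e3 : ∀ i (o : N.Op), N.backlog (fun i k => N.joinedBacklog U i k.1 k.2.1) i o.1
      o.copy = N.joinedBacklog U i o.1 o.copy :=
    fun i o => backlog_joinedBacklog U i o.1 o.2.2.2.1.2
  have e4 : ∀ i (o : N.ProcOp) (b : ℝ), o.scale * x.proc i o * b = x.proc i o * (o.scale * b) :=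
    fun i o b => by ring
  simp only [e1, e2, e3, e4]
  ring

/-- The total weight of the operations of a decision is the drift that it exerts on the backlogs
minus `V` times its cost. -/
theorem sum_weight (V : ℝ) (U : N.Vec) (x : N.Decision) :
    (∑ i, ∑ o : N.ProcOp, x.proc i o * (o.work * N.procWeight V U i o)) +
      (∑ e : {e : Node × Node // e ∈ N.links}, ∑ o : N.Op,
        x.trans e o * N.linkWeight V U e.1 o) =
    (∑ i, ∑ k, U i k * (N.outflow x i k - N.joins (N.inflow x) i k)) - V * N.cost x := by
  simp only [mul_sub, Finset.sum_sub_distrib, sum_mul_outflow, sum_mul_joins_inflow, cost]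
  have hp : ∀ i (o : N.ProcOp), x.proc i o * (o.work * N.procWeight V U i o) =
      x.proc i o * N.backlog U i o.1.1 o.1.orig -
      x.proc i o * (o.scale * N.joinedBacklog U i o.out o.1.copy +
        N.joinedBacklog U i o.1.1 o.1.reload) -
      V * (N.procCost i * (o.work * x.proc i o)) := by
    intro i o
    have := (N.work_pos _ _ o.2).ne'
    unfold procWeight
    field_simp
    ring
  have hl : ∀ (e : {e : Node × Node // e ∈ N.links}) (o : N.Op),
      x.trans e o * N.linkWeight V U e.1 o =
      x.trans e o * N.backlog U e.1.1 o.1 o.orig -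
      x.trans e o * (N.joinedBacklog U e.1.2 o.1 o.copy +
        N.joinedBacklog U e.1.1 o.1 o.reload) -
      V * (N.linkCost e.1 * x.trans e o) := by
    intro e o
    unfold linkWeight
    ring
  simp only [hp, hl, Finset.sum_sub_distrib, mul_add, Finset.mul_sum]
  ring

/-! ### Max-weight beats every decision, inefficient duplication included -/

omit [Fintype Node] [Fintype Srv] [DecidableEq Srv] in
theorem backlog_commodity (Q : N.Vec) (i : Node) (k : N.Commodity) :
    N.backlog Q i k.1 k.2.1 = Q i k :=
  dif_pos k.2.2

/-- The largest backlog, at the same node and of the same stream, of a queue with at most the given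
destinations (or `0`, for no destination). It serves as a price for queueing a packet some of whose
destinations may be dropped. -/
noncomputable def maxSubBacklog (Q : N.Vec) : N.Vec := fun i k =>
  k.2.1.powerset.sup' (Finset.powerset_nonempty _) (N.backlog Q i k.1)

section

omit [Fintype Node] [Fintype Srv] [DecidableEq Srv]

theorem exists_backlog_maxSubBacklog (Q : N.Vec) (i : Node) (c : N.Stream) (q : Finset Node) :
    ∃ p ⊆ q, N.backlog (maxSubBacklog Q) i c q = N.backlog Q i c p := by
  unfold backlog
  split_ifs with h
  · obtain ⟨p, hp, hpe⟩ := Finset.exists_mem_eq_sup' (Finset.powerset_nonempty q)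
      (N.backlog Q i c)
    exact ⟨p, Finset.mem_powerset.1 hp, hpe⟩
  · exact ⟨∅, Finset.empty_subset _, by simp⟩

theorem backlog_le_maxSubBacklog (Q : N.Vec) (i : Node) (c : N.Stream) {p q : Finset Node}
    (hpq : p ⊆ q) (hq : q ⊆ c.dest) :
    N.backlog Q i c p ≤ N.backlog (maxSubBacklog Q) i c q := by
  rcases q.eq_empty_or_nonempty with rfl | hne
  · simp [Finset.subset_empty.1 hpq]
  · rw [show N.backlog (maxSubBacklog Q) i c q = maxSubBacklog Q i ⟨c, q, hne, hq⟩ from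
      dif_pos ⟨hne, hq⟩]
    exact Finset.le_sup' (N.backlog Q i c) (Finset.mem_powerset.2 hpq)

theorem joinedBacklog_le_maxSubBacklog (Q : N.Vec) (i : Node) (c : N.Stream) {p q : Finset Node}
    (hpq : p ⊆ q) (hq : q ⊆ c.dest) :
    N.joinedBacklog Q i c p ≤ N.joinedBacklog (maxSubBacklog Q) i c q := by
  unfold joinedBacklog
  split_ifs
  · exact backlog_le_maxSubBacklog Q i c (Finset.erase_subset_erase i hpq)
      ((Finset.erase_subset i q).trans hq)
  · exact backlog_le_maxSubBacklog Q i c hpq hq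

theorem le_maxSubBacklog (Q : N.Vec) (i : Node) (k : N.Commodity) :
    Q i k ≤ maxSubBacklog Q i k := by
  rw [← backlog_commodity Q, ← backlog_commodity (maxSubBacklog Q)]
  exact backlog_le_maxSubBacklog Q i k.1 subset_rfl k.2.2.2

theorem backlog_le_joinedBacklog {Q : N.Vec} (h0 : ∀ i k, 0 ≤ Q i k)
    (hc : ∀ i k, N.Consumed i k → Q i k = 0) (i : Node) (c : N.Stream) (p : Finset Node) :
    N.backlog Q i c p ≤ N.joinedBacklog Q i c p := by
  have hb : ∀ q, 0 ≤ N.backlog Q i c q := fun q => by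
    unfold backlog
    split_ifs
    exacts [h0 _ _, le_rfl]
  by_cases hf : c.IsFinal ∧ i ∈ p
  · refine le_trans (le_of_eq ?_) (hb _)
    unfold backlog
    split_ifs with h
    · exact hc i ⟨c, p, h⟩ hf
    · rfl
  · unfold joinedBacklog
    split_ifs with hfin
    · rw [Finset.erase_eq_of_notMem fun hi => hf ⟨hfin, hi⟩]
    · exact le_rfl

/-- Restricting an operation to a part `p` of the original destinations that meets the status of
the operated copy gives an efficient operation. -/
def Op.restrict (o : N.Op) (p : Finset Node) (hp : p ⊆ o.orig) (hne : (p ∩ o.copy).Nonempty) :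
    N.Op :=
  ⟨o.1, (p, p ∩ o.copy, p \ o.copy),
    ⟨hne.mono Finset.inter_subset_left, hp.trans o.2.2.1.2⟩,
    ⟨hne, Finset.inter_subset_right.trans o.2.2.2.1.2⟩,
    (Finset.sdiff_subset.trans hp).trans o.2.2.1.2, by
      rw [Finset.union_comm, Finset.sdiff_union_inter]⟩

theorem Op.restrict_efficient (o : N.Op) (p : Finset Node) (hp : p ⊆ o.orig)
    (hne : (p ∩ o.copy).Nonempty) : (o.restrict p hp hne).Efficient :=
  ⟨(Finset.disjoint_sdiff_inter p o.copy).symm, by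
    change p = p ∩ o.copy ∪ p \ o.copy
    rw [Finset.union_comm, Finset.sdiff_union_inter]⟩

theorem sdiff_subset_reload (o : N.Op) {p : Finset Node} (hp : p ⊆ o.orig) :
    p \ o.copy ⊆ o.reload := fun x hx => by
  rw [Finset.mem_sdiff] at hx
  exact (Finset.mem_union.1 (o.2.2.2.2.2 (hp hx.1))).resolve_left hx.2

/-- The combinatorial core of the comparison: at the prices `maxSubBacklog Q`, any operation either
earns nothing, or earns at most what an efficient operation of the same stream earns at the prices
`Q`. The witness restricts the operation to the destinations `p` that attain the price of the
original packet. If none of them is in the operated copy, then all of them are reloaded. -/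
theorem maxSubBacklog_gain {Q : N.Vec} (h0 : ∀ i k, 0 ≤ Q i k)
    (hc : ∀ i k, N.Consumed i k → Q i k = 0) (i : Node) (o : N.Op) :
    N.backlog (maxSubBacklog Q) i o.1 o.orig
        ≤ N.joinedBacklog (maxSubBacklog Q) i o.1 o.reload ∨
      ∃ (p : Finset Node) (hp : p ⊆ o.orig) (hne : (p ∩ o.copy).Nonempty),
        N.backlog (maxSubBacklog Q) i o.1 o.orig
            - N.joinedBacklog (maxSubBacklog Q) i o.1 o.reload ≤
          N.backlog Q i o.1 (o.restrict p hp hne).orig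
            - N.joinedBacklog Q i o.1 (o.restrict p hp hne).reload := by
  obtain ⟨p, hp, hpe⟩ := exists_backlog_maxSubBacklog Q i o.1 o.orig
  have hr := joinedBacklog_le_maxSubBacklog Q i o.1 (sdiff_subset_reload o hp) o.2.2.2.2.1
  rcases (p ∩ o.copy).eq_empty_or_nonempty with he | hne
  · left
    rw [Finset.sdiff_eq_self_of_disjoint (Finset.disjoint_iff_inter_eq_empty.2 he)] at hr
    exact hpe.trans_le ((backlog_le_joinedBacklog h0 hc i o.1 p).trans hr)
  · exact Or.inr ⟨p, hp, hne, sub_le_sub hpe.le hr⟩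

theorem joinedBacklog_maxSubBacklog_nonneg (Q : N.Vec) (i : Node) (c : N.Stream)
    {q : Finset Node} (hq : q ⊆ c.dest) : 0 ≤ N.joinedBacklog (maxSubBacklog Q) i c q := by
  simpa using joinedBacklog_le_maxSubBacklog Q i c (Finset.empty_subset q) hq

theorem procWeight_maxSubBacklog_le {V : ℝ} (hV : 0 ≤ V) {Q : N.Vec} (h0 : ∀ i k, 0 ≤ Q i k)
    (hc : ∀ i k, N.Consumed i k → Q i k = 0) (i : Node) (o : N.ProcOp) :
    N.procWeight V (maxSubBacklog Q) i o ≤ 0 ∨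
      ∃ o' : N.ProcOp, o'.1.Efficient ∧
        N.procWeight V (maxSubBacklog Q) i o ≤ N.procWeight V Q i o' := by
  have hw : 0 < o.work := N.work_pos _ _ o.2
  have hξ : 0 ≤ o.scale := N.scale_nonneg _ _ o.2
  rcases maxSubBacklog_gain h0 hc i o.1 with h | ⟨p, hp, hne, h⟩
  · left
    have h1 := mul_nonneg hξ
      (joinedBacklog_maxSubBacklog_nonneg Q i o.out (q := o.1.copy) o.1.2.2.2.1.2)
    have h2 := mul_nonneg hV (N.procCost_nonneg i)
    have h3 := div_nonpos_of_nonpos_of_nonneg (a := N.backlog (maxSubBacklog Q) i o.1.1 o.1.orig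
      - N.joinedBacklog (maxSubBacklog Q) i o.1.1 o.1.reload
      - o.scale * N.joinedBacklog (maxSubBacklog Q) i o.out o.1.copy) (by linarith) hw.le
    unfold procWeight
    linarith
  · refine Or.inr ⟨⟨o.1.restrict p hp hne, o.2⟩, o.1.restrict_efficient p hp hne, ?_⟩
    refine sub_le_sub_right (div_le_div_of_nonneg_right (sub_le_sub h ?_) hw.le) _
    exact mul_le_mul_of_nonneg_left
      (joinedBacklog_le_maxSubBacklog Q i o.out Finset.inter_subset_right o.1.2.2.2.1.2) hξ

theorem linkWeight_maxSubBacklog_le {V : ℝ} (hV : 0 ≤ V) {Q : N.Vec} (h0 : ∀ i k, 0 ≤ Q i k)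
    (hc : ∀ i k, N.Consumed i k → Q i k = 0) {e : Node × Node} (he : e ∈ N.links) (o : N.Op) :
    N.linkWeight V (maxSubBacklog Q) e o ≤ 0 ∨
      ∃ o' : N.Op, o'.Efficient ∧ N.linkWeight V (maxSubBacklog Q) e o ≤ N.linkWeight V Q e o' := by
  rcases maxSubBacklog_gain h0 hc e.1 o with h | ⟨p, hp, hne, h⟩
  · left
    have h1 := joinedBacklog_maxSubBacklog_nonneg Q e.2 o.1 (q := o.copy) o.2.2.2.1.2
    have h2 := mul_nonneg hV (N.linkCost_nonneg e he)
    unfold linkWeight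
    linarith
  · refine Or.inr ⟨o.restrict p hp hne, o.restrict_efficient p hp hne, ?_⟩
    exact sub_le_sub_right (sub_le_sub h
      (joinedBacklog_le_maxSubBacklog Q e.2 o.1 Finset.inter_subset_right o.2.2.2.1.2)) _

end

/-- At a single interface, with capacity `C` and resource usage `g o` per unit of operation `o`,
the max-weight rule maximizes the total weight, even against weights `v` that are dominated by the
positive parts of the weights of admitted operations. -/
theorem MaxWeightRule.sum_le {ι : Type*} [Fintype ι] {adm : ι → Prop} {w full x : ι → ℝ}
    (h : MaxWeightRule adm w full x) {g v z : ι → ℝ} {C : ℝ} (hg : ∀ o, 0 ≤ g o)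
    (hfull : ∀ o, full o * g o = C) (hz : ∀ o, 0 ≤ z o) (hcap : ∑ o, g o * z o ≤ C)
    (hv : ∀ o, v o ≤ 0 ∨ ∃ o', adm o' ∧ v o ≤ w o') :
    ∑ o, z o * (g o * v o) ≤ ∑ o, x o * (g o * w o) := by
  have key : ∀ M, 0 ≤ M → (∀ o, v o ≤ M) → ∑ o, z o * (g o * v o) ≤ C * M := by
    intro M hM hvM
    calc ∑ o, z o * (g o * v o) ≤ ∑ o, g o * z o * M := Finset.sum_le_sum fun o _ => by
          have := mul_le_mul_of_nonneg_left (hvM o) (mul_nonneg (hg o) (hz o))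
          linarith
      _ = (∑ o, g o * z o) * M := (Finset.sum_mul ..).symm
      _ ≤ C * M := mul_le_mul_of_nonneg_right hcap hM
  rcases h with ⟨hno, hx⟩ | ⟨o, -, hmax, hpos, hneg, hne⟩
  · simpa [hx] using key 0 le_rfl fun o => (hv o).resolve_right fun ⟨o', h', _⟩ => hno o' h'
  · have hx : ∑ o', x o' * (g o' * w o') = x o * (g o * w o) :=
      Finset.sum_eq_single o (fun o' _ h' => by simp [hne o' h']) (by simp)
    rw [hx]
    by_cases hw : 0 < w o
    · rw [hpos hw, ← mul_assoc, hfull]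
      exact key _ hw.le fun o' => (hv o').elim (fun h' => h'.trans hw.le)
        fun ⟨o'', h', h''⟩ => h''.trans (hmax o'' h')
    · rw [hneg hw, zero_mul]
      simpa using key 0 le_rfl fun o' => (hv o').elim id
        fun ⟨o'', h', h''⟩ => h''.trans ((hmax o'' h').trans (not_lt.1 hw))

theorem MaxWeightRule.nonneg {ι : Type*} {adm : ι → Prop} {w full x : ι → ℝ}
    (h : MaxWeightRule adm w full x) (hfull : ∀ o, 0 ≤ full o) (o : ι) : 0 ≤ x o := by
  rcases h with ⟨-, hx⟩ | ⟨o', -, -, hpos, hneg, hne⟩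
  · rw [hx]
  · by_cases ho : o = o'
    · subst ho
      by_cases hw : 0 < w o
      · rw [hpos hw]
        exact hfull o
      · rw [hneg hw]
    · rw [hne o ho]

theorem MaxWeightRule.sum_le_cap {ι : Type*} [Fintype ι] {adm : ι → Prop} {w full x : ι → ℝ}
    (h : MaxWeightRule adm w full x) {g : ι → ℝ} {C : ℝ} (hC : 0 ≤ C)
    (hfull : ∀ o, full o * g o = C) : ∑ o, g o * x o ≤ C := by
  rcases h with ⟨-, hx⟩ | ⟨o, -, -, hpos, hneg, hne⟩
  · simpa [hx] using hC
  · rw [Finset.sum_eq_single o (fun o' _ h' => by simp [hne o' h']) (by simp)]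
    by_cases hw : 0 < w o
    · rw [hpos hw, mul_comm, hfull]
    · simpa [hneg hw] using hC

omit [DecidableEq Srv] in
theorem IsMaxWeight.feasible {V : ℝ} {Q : N.Vec} {x : N.Decision} (h : N.IsMaxWeight V Q x) :
    N.Feasible x where
  proc_nonneg i := (h.1 i).nonneg fun o => div_nonneg (N.procCap_nonneg i) (N.work_pos _ _ o.2).le
  trans_nonneg e := (h.2 e).nonneg fun _ => N.linkCap_nonneg e.1 e.2
  proc_cap i := (h.1 i).sum_le_cap (N.procCap_nonneg i) fun o =>
    div_mul_cancel₀ _ (N.work_pos _ _ o.2).ne'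
  trans_cap e := by
    simpa using (h.2 e).sum_le_cap (g := fun _ => 1) (N.linkCap_nonneg e.1 e.2) fun _ => mul_one _

/-- The stationary decision `z` supports the rates `mu`: it is feasible, and for each queue the
flow joining it is at most the flow taken from it. -/
def Supports (z : N.Decision) (mu : N.Vec) : Prop :=
  N.Feasible z ∧ ∀ i k, ¬ N.Consumed i k →
    N.joins (fun j l => N.inflow z j l + mu j l) i k ≤ N.outflow z i k

/-- A max-weight decision is at least as good, in the drift-minus-cost objective, as every
stationary decision that supports rates `mu`, although the latter may use inefficient
operations. -/
theorem IsMaxWeight.drift_ge {V : ℝ} (hV : 0 ≤ V) {Q : N.Vec} (h0 : ∀ i k, 0 ≤ Q i k)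
    (hc : ∀ i k, N.Consumed i k → Q i k = 0) {x z : N.Decision} (hx : N.IsMaxWeight V Q x)
    {mu : N.Vec} (hmu : ∀ i k, 0 ≤ mu i k) (hz : Supports z mu) :
    (∑ i, ∑ k, Q i k * N.joins mu i k) - V * N.cost z ≤
      (∑ i, ∑ k, Q i k * (N.outflow x i k - N.joins (N.inflow x) i k)) - V * N.cost x := by
  rw [← sum_weight V Q x]
  have hle : (∑ i, ∑ o : N.ProcOp, z.proc i o * (o.work * N.procWeight V (maxSubBacklog Q) i o)) +
      (∑ e : {e : Node × Node // e ∈ N.links}, ∑ o : N.Op,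
        z.trans e o * N.linkWeight V (maxSubBacklog Q) e.1 o) ≤
      (∑ i, ∑ o : N.ProcOp, x.proc i o * (o.work * N.procWeight V Q i o)) +
      (∑ e : {e : Node × Node // e ∈ N.links}, ∑ o : N.Op,
        x.trans e o * N.linkWeight V Q e.1 o) := by
    refine add_le_add (Finset.sum_le_sum fun i _ => ?_) (Finset.sum_le_sum fun e _ => ?_)
    · exact (hx.1 i).sum_le (fun o => (N.work_pos _ _ o.2).le)
        (fun o => div_mul_cancel₀ _ (N.work_pos _ _ o.2).ne') (hz.1.proc_nonneg i)
        (hz.1.proc_cap i) (procWeight_maxSubBacklog_le hV h0 hc i)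
    · simpa using (hx.2 e).sum_le (g := fun _ => 1) (fun _ => zero_le_one)
        (fun _ => mul_one _) (hz.1.trans_nonneg e)
        (by simpa using hz.1.trans_cap e) (linkWeight_maxSubBacklog_le hV h0 hc e.2)
  refine le_trans ?_ hle
  rw [sum_weight V (maxSubBacklog Q) z]
  refine sub_le_sub_right (Finset.sum_le_sum fun i _ => Finset.sum_le_sum fun k _ => ?_) _
  have hU := le_maxSubBacklog Q i k
  have hJ := joins_nonneg (hmu i) k
  refine (mul_le_mul_of_nonneg_right hU hJ).trans
    (mul_le_mul_of_nonneg_left ?_ ((h0 i k).trans hU))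
  by_cases hk : N.Consumed i k
  · rw [joins_consumed _ hk, joins_consumed _ hk, sub_zero]
    exact hz.1.nonneg_of_form (nonnegForm_outflow i k)
  · have := hz.2 i k hk
    rw [joins_add (N.inflow z) mu] at this
    linarith

/-! ### Quadratic drift of the backlogs -/

theorem sq_queue_step_le {Q o J J' : ℝ} (hQ : 0 ≤ Q) (ho : 0 ≤ o) (hJ : 0 ≤ J) (hJJ : J ≤ J') :
    (max (Q - o) 0 + J) ^ 2 ≤ Q ^ 2 + (o ^ 2 + J' ^ 2) - 2 * (Q * (o - J')) := by
  have h1 : max (Q - o) 0 ≤ Q := max_le (by linarith) hQ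
  have h2 : max (Q - o) 0 ^ 2 ≤ (Q - o) ^ 2 := by
    rcases le_total (Q - o) 0 with h | h
    · rw [max_eq_right h, zero_pow two_ne_zero]
      exact sq_nonneg _
    · rw [max_eq_left h]
  have h3 : max (Q - o) 0 * J ≤ Q * J' := mul_le_mul h1 hJJ hJ hQ
  have h4 : J ^ 2 ≤ J' ^ 2 := pow_le_pow_left₀ hJ hJJ 2
  nlinarith

/-- The quadratic Lyapunov function. -/
def sqBacklog (Q : N.Vec) : ℝ := ∑ i, ∑ k, Q i k ^ 2

/-- A part of the drift bound that does not depend on the backlogs: the capacities bound the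
controlled flows, and the arrivals `a` enter through their squares. -/
theorem exists_flow_bound (N : CloudNetwork Node Srv) :
    ∃ K : ℝ, 0 ≤ K ∧ ∀ x : N.Decision, N.Feasible x → ∀ a : N.Vec,
      ∑ i, ∑ k, (N.outflow x i k ^ 2 + N.joins (fun j l => N.inflow x j l + a j l) i k ^ 2) ≤
        K + ∑ i, ∑ _k : N.Commodity, 2 * (Fintype.card N.Commodity * ∑ k', a i k' ^ 2) := by
  choose Ko hKo0 hKo using fun (i : Node) (k : N.Commodity) =>
    (nonnegForm_outflow i k).exists_bound
  choose Ki hKi0 hKi using fun (i : Node) (k : N.Commodity) =>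
    (nonnegForm_joins_inflow i k).exists_bound
  refine ⟨∑ i, ∑ k, (Ko i k ^ 2 + 2 * Ki i k ^ 2), by positivity, fun x hx a => ?_⟩
  simp only [← Finset.sum_add_distrib (s := (Finset.univ : Finset Node)),
    ← Finset.sum_add_distrib (s := (Finset.univ : Finset N.Commodity))]
  refine Finset.sum_le_sum fun i _ => Finset.sum_le_sum fun k _ => ?_
  rw [joins_add (N.inflow x) a]
  have h1 := pow_le_pow_left₀ (hx.nonneg_of_form (nonnegForm_outflow i k)) (hKo i k x hx) 2
  have h2 := pow_le_pow_left₀ (hx.nonneg_of_form (nonnegForm_joins_inflow i k)) (hKi i k x hx) 2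
  have h3 := joins_sq_le a i k
  have h4 := add_sq_le (a := N.joins (N.inflow x) i k) (b := N.joins a i k)
  linarith

section Run

variable {Ω : Type*} [m : MeasurableSpace Ω] {P : Measure Ω} {ℱ : Filtration ℕ m}
  {a : ℕ → Ω → N.Vec} {lam : N.Vec} {V : ℝ} {Q : ℕ → Ω → N.Vec} {x y : ℕ → Ω → N.Decision}

namespace IsMaxWeightRun

theorem feasible (hr : N.IsMaxWeightRun P ℱ a V Q x y) (t : ℕ) (ω : Ω) : N.Feasible (x t ω) :=
  (hr.maxWeight t ω).feasible

theorem form_le (hr : N.IsMaxWeightRun P ℱ a V Q x y) {F : N.Decision → ℝ} (hF : NonnegForm N F)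
    (t : ℕ) (ω : Ω) : F (y t ω) ≤ F (x t ω) :=
  hF.mono (fun i o => (hr.y_proc t ω i o).2) fun e o => (hr.y_trans t ω e o).2

theorem form_nonneg (hr : N.IsMaxWeightRun P ℱ a V Q x y) {F : N.Decision → ℝ}
    (hF : NonnegForm N F) (t : ℕ) (ω : Ω) : 0 ≤ F (y t ω) :=
  hF.nonneg (fun i o => (hr.y_proc t ω i o).1) fun e o => (hr.y_trans t ω e o).1

theorem feasible_operated (hr : N.IsMaxWeightRun P ℱ a V Q x y) (t : ℕ) (ω : Ω) :
    N.Feasible (y t ω) where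
  proc_nonneg i o := (hr.y_proc t ω i o).1
  trans_nonneg e o := (hr.y_trans t ω e o).1
  proc_cap i := (hr.form_le (nonnegForm_work i) t ω).trans ((hr.feasible t ω).proc_cap i)
  trans_cap e := (hr.form_le (nonnegForm_load e) t ω).trans ((hr.feasible t ω).trans_cap e)

theorem backlog_nonneg (hr : N.IsMaxWeightRun P ℱ a V Q x y) (ha : ∀ t ω i k, 0 ≤ a t ω i k)
    (t : ℕ) (ω : Ω) (i : Node) (k : N.Commodity) : 0 ≤ Q t ω i k := by
  rcases t with _ | t
  · exact hr.init_nonneg ω i k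
  · by_cases hk : N.Consumed i k
    · exact (hr.consumed (t + 1) ω i k hk).ge
    · rw [hr.step t ω i k hk]
      exact add_nonneg (le_max_right _ _) (joins_nonneg (fun l =>
        add_nonneg (hr.form_nonneg (nonnegForm_inflow i l) t ω) (ha t ω i l)) k)

/-- The drift-plus-penalty inequality, pathwise: whatever stationary decision `z` supports rates
`mu` bounds the change of the Lyapunov function. -/
theorem sqBacklog_step_le (hr : N.IsMaxWeightRun P ℱ a V Q x y) (ha : ∀ t ω i k, 0 ≤ a t ω i k)
    (hV : 0 ≤ V) {mu : N.Vec} (hmu : ∀ i k, 0 ≤ mu i k) {z : N.Decision} (hz : Supports z mu)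
    (t : ℕ) (ω : Ω) :
    sqBacklog (Q (t + 1) ω) + 2 * V * N.cost (x t ω) ≤
      sqBacklog (Q t ω) + 2 * V * N.cost z +
      ∑ i, ∑ k, (N.outflow (x t ω) i k ^ 2 +
        N.joins (fun j l => N.inflow (x t ω) j l + a t ω j l) i k ^ 2) +
      2 * ∑ i, ∑ k, Q t ω i k * (N.joins (a t ω) i k - N.joins mu i k) := by
  have h0 := hr.backlog_nonneg ha t ω
  have hdrift := (hr.maxWeight t ω).drift_ge hV h0 (hr.consumed t ω) hmu hz
  have hstep : sqBacklog (Q (t + 1) ω) ≤ ∑ i, ∑ k, (Q t ω i k ^ 2 +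
      (N.outflow (x t ω) i k ^ 2 +
        N.joins (fun j l => N.inflow (x t ω) j l + a t ω j l) i k ^ 2) -
      2 * (Q t ω i k * (N.outflow (x t ω) i k -
        N.joins (fun j l => N.inflow (x t ω) j l + a t ω j l) i k))) := by
    refine Finset.sum_le_sum fun i _ => Finset.sum_le_sum fun k _ => ?_
    by_cases hk : N.Consumed i k
    · rw [hr.consumed _ ω i k hk, hr.consumed _ ω i k hk]
      nlinarith [sq_nonneg (N.outflow (x t ω) i k),
        sq_nonneg (N.joins (fun j l => N.inflow (x t ω) j l + a t ω j l) i k)]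
    · rw [hr.step t ω i k hk]
      refine sq_queue_step_le (h0 i k)
        ((hr.feasible t ω).nonneg_of_form (nonnegForm_outflow i k)) (joins_nonneg (fun l =>
        add_nonneg (hr.form_nonneg (nonnegForm_inflow i l) t ω) (ha t ω i l)) k)
        (joins_mono (fun l => ?_) k)
      exact add_le_add_left (hr.form_le (nonnegForm_inflow i l) t ω) _
  have hJ : ∀ i k, N.joins (fun j l => N.inflow (x t ω) j l + a t ω j l) i k =
      N.joins (N.inflow (x t ω)) i k + N.joins (a t ω) i k :=
    fun i k => joins_add (N.inflow (x t ω)) (a t ω) i k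
  have hsplit : (∑ i, ∑ k, (Q t ω i k ^ 2 +
      (N.outflow (x t ω) i k ^ 2 +
        N.joins (fun j l => N.inflow (x t ω) j l + a t ω j l) i k ^ 2) -
      2 * (Q t ω i k * (N.outflow (x t ω) i k -
        N.joins (fun j l => N.inflow (x t ω) j l + a t ω j l) i k)))) =
      sqBacklog (Q t ω) + ∑ i, ∑ k, (N.outflow (x t ω) i k ^ 2 +
        N.joins (fun j l => N.inflow (x t ω) j l + a t ω j l) i k ^ 2) -
      2 * (∑ i, ∑ k, Q t ω i k * (N.outflow (x t ω) i k - N.joins (N.inflow (x t ω)) i k)) +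
      2 * ∑ i, ∑ k, Q t ω i k * N.joins (a t ω) i k := by
    simp only [sqBacklog, hJ, Finset.mul_sum, ← Finset.sum_add_distrib, ← Finset.sum_sub_distrib]
    exact Finset.sum_congr rfl fun i _ => Finset.sum_congr rfl fun k _ => by ring
  have hsub : (∑ i, ∑ k, Q t ω i k * (N.joins (a t ω) i k - N.joins mu i k)) =
      (∑ i, ∑ k, Q t ω i k * N.joins (a t ω) i k) - ∑ i, ∑ k, Q t ω i k * N.joins mu i k := by
    simp only [mul_sub, Finset.sum_sub_distrib]
  rw [hsub]
  linarith

end IsMaxWeightRun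

/-! ### Integrability and expectations -/

variable [IsProbabilityMeasure P]

/-- The entrywise expectation of a random decision. -/
noncomputable def meanDecision (P : Measure Ω) (d : Ω → N.Decision) : N.Decision :=
  ⟨fun i o => ∫ ω, (d ω).proc i o ∂P, fun e o => ∫ ω, (d ω).trans e o ∂P⟩

omit [DecidableEq Srv] in
theorem NonnegForm.integral {F : N.Decision → ℝ} (hF : NonnegForm N F) {d : Ω → N.Decision}
    (hp : ∀ i o, Measurable fun ω => (d ω).proc i o)
    (ht : ∀ e o, Measurable fun ω => (d ω).trans e o) (hd : ∀ ω, N.Feasible (d ω)) :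
    Integrable (fun ω => F (d ω)) P ∧ ∫ ω, F (d ω) ∂P = F (meanDecision P d) := by
  induction hF with
  | zero => simp
  | proc i o =>
    exact ⟨Integrable.of_mem_Icc 0 _ (hp i o).aemeasurable
      (ae_of_all _ fun ω => ⟨(hd ω).proc_nonneg i o, (hd ω).proc_le i o⟩), rfl⟩
  | trans e o =>
    exact ⟨Integrable.of_mem_Icc 0 _ (ht e o).aemeasurable
      (ae_of_all _ fun ω => ⟨(hd ω).trans_nonneg e o, (hd ω).trans_le e o⟩), rfl⟩
  | add _ _ h1 h2 => exact ⟨h1.1.add h2.1, by rw [integral_add h1.1 h2.1, h1.2, h2.2]⟩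
  | smul c _ _ h => exact ⟨h.1.const_mul c, by rw [integral_const_mul, h.2]⟩

omit [DecidableEq Srv] in
theorem feasible_meanDecision {d : Ω → N.Decision}
    (hp : ∀ i o, Measurable fun ω => (d ω).proc i o)
    (ht : ∀ e o, Measurable fun ω => (d ω).trans e o) (hd : ∀ ω, N.Feasible (d ω)) :
    N.Feasible (meanDecision P d) where
  proc_nonneg i o := integral_nonneg fun ω => (hd ω).proc_nonneg i o
  trans_nonneg e o := integral_nonneg fun ω => (hd ω).trans_nonneg e o
  proc_cap i := by
    have h := (nonnegForm_work i).integral (P := P) hp ht hd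
    rw [← h.2]
    exact (integral_mono h.1 (integrable_const _) fun ω => (hd ω).proc_cap i).trans (by simp)
  trans_cap e := by
    have h := (nonnegForm_load e).integral (P := P) hp ht hd
    rw [← h.2]
    exact (integral_mono h.1 (integrable_const _) fun ω => (hd ω).trans_cap e).trans (by simp)

namespace IsIIDArrivals

omit [Fintype Node] [Fintype Srv] [DecidableEq Srv] [IsProbabilityMeasure P] in
theorem sq_le (hA : N.IsIIDArrivals P ℱ a lam) {A : ℝ}
    (h2 : ∀ i k, ∫ ω, (a 0 ω i k) ^ 2 ∂P ≤ A) (t : ℕ) (i : Node) (k : N.Commodity) :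
    ∫ ω, (a t ω i k) ^ 2 ∂P ≤ A := by
  have hu : Measurable fun v : N.Vec => v i k ^ 2 :=
    ((measurable_pi_apply k).comp (measurable_pi_apply i)).pow_const 2
  exact ((hA.identDistrib t).comp hu).integral_eq.trans_le (h2 i k)

omit [Fintype Node] [Fintype Srv] [DecidableEq Srv] [IsProbabilityMeasure P] in
theorem rate_nonneg (hA : N.IsIIDArrivals P ℱ a lam) (i : Node) (k : N.Commodity) :
    0 ≤ lam i k := by
  rw [← hA.mean 0 i k]
  exact integral_nonneg fun ω => hA.nonneg 0 ω i k

omit [Fintype Node] [Fintype Srv] [DecidableEq Srv] in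
theorem integrable (hA : N.IsIIDArrivals P ℱ a lam) (t : ℕ) (i : Node) (k : N.Commodity) :
    Integrable (fun ω => a t ω i k) P :=
  (hA.memLp_two t i k).integrable one_le_two

omit [IsProbabilityMeasure P] in
theorem memLp_joins (hA : N.IsIIDArrivals P ℱ a lam) (t : ℕ) (i : Node) (k : N.Commodity) :
    MemLp (fun ω => N.joins (a t ω) i k) 2 P := by
  refine memLp_finsetSum _ fun k' _ => ?_
  split_ifs
  exacts [hA.memLp_two t i k', MemLp.zero']

theorem integral_joins (hA : N.IsIIDArrivals P ℱ a lam) (t : ℕ) (i : Node) (k : N.Commodity) :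
    ∫ ω, N.joins (a t ω) i k ∂P = N.joins lam i k := by
  unfold joins
  rw [integral_finsetSum]
  · refine Finset.sum_congr rfl fun k' _ => ?_
    split_ifs
    exacts [hA.mean t i k', integral_zero _ _]
  · intro k' _
    split_ifs
    exacts [hA.integrable t i k', integrable_zero _ _ _]

end IsIIDArrivals

namespace IsMaxWeightRun

omit [IsProbabilityMeasure P] in
theorem measurable_backlog (hr : N.IsMaxWeightRun P ℱ a V Q x y) (t : ℕ) (i : Node)
    (k : N.Commodity) : Measurable fun ω => Q t ω i k :=
  (measurable_pi_apply k).comp ((measurable_pi_apply i).comp ((hr.adapted t).mono (ℱ.le t) le_rfl))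

theorem memLp_backlog (hr : N.IsMaxWeightRun P ℱ a V Q x y) (hA : N.IsIIDArrivals P ℱ a lam)
    (t : ℕ) (i : Node) (k : N.Commodity) : MemLp (fun ω => Q t ω i k) 2 P := by
  induction t with
  | zero => exact hr.init_memLp_two i k
  | succ t ih =>
    by_cases hk : N.Consumed i k
    · simpa only [hr.consumed _ _ i k hk] using MemLp.zero'
    obtain ⟨K, hK, hKx⟩ := (nonnegForm_joins_inflow (N := N) i k).exists_bound
    refine ((ih.add (memLp_const K)).add (hA.memLp_joins t i k)).of_le
      (hr.measurable_backlog _ i k).aestronglyMeasurable (ae_of_all _ fun ω => ?_)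
    have h0 := hr.backlog_nonneg hA.nonneg t ω i k
    have hj := joins_nonneg (hA.nonneg t ω i) k
    have ho := (hr.feasible t ω).nonneg_of_form (nonnegForm_outflow i k)
    have hx := hKx _ (hr.feasible_operated t ω)
    have hm : max (Q t ω i k - N.outflow (x t ω) i k) 0 ≤ Q t ω i k := max_le (by linarith) h0
    simp only [Pi.add_apply]
    rw [Real.norm_of_nonneg (hr.backlog_nonneg hA.nonneg _ ω i k),
      Real.norm_of_nonneg (by positivity), hr.step t ω i k hk,
      joins_add (N.inflow (y t ω)) (a t ω)]
    linarith

theorem integrable_backlog (hr : N.IsMaxWeightRun P ℱ a V Q x y)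
    (hA : N.IsIIDArrivals P ℱ a lam) (t : ℕ) (i : Node) (k : N.Commodity) :
    Integrable (fun ω => Q t ω i k) P :=
  (hr.memLp_backlog hA t i k).integrable one_le_two

theorem integrable_totalBacklog (hr : N.IsMaxWeightRun P ℱ a V Q x y)
    (hA : N.IsIIDArrivals P ℱ a lam) (t : ℕ) :
    Integrable (fun ω => N.totalBacklog (Q t ω)) P :=
  integrable_finsetSum _ fun i _ => integrable_finsetSum _ fun k _ =>
    (hr.integrable_backlog hA t i k).abs

theorem integrable_sqBacklog (hr : N.IsMaxWeightRun P ℱ a V Q x y)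
    (hA : N.IsIIDArrivals P ℱ a lam) (t : ℕ) :
    Integrable (fun ω => sqBacklog (Q t ω)) P :=
  integrable_finsetSum _ fun i _ => integrable_finsetSum _ fun k _ =>
    (hr.memLp_backlog hA t i k).integrable_sq

theorem integrable_cost (hr : N.IsMaxWeightRun P ℱ a V Q x y) (t : ℕ) :
    Integrable (fun ω => N.cost (x t ω)) P :=
  (nonnegForm_cost.integral (hr.meas_x_proc t) (hr.meas_x_trans t) (hr.feasible t)).1

/-- The backlogs are uncorrelated with the fluctuations of the arrivals in the same slot. -/
theorem integral_backlog_mul (hr : N.IsMaxWeightRun P ℱ a V Q x y)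
    (hA : N.IsIIDArrivals P ℱ a lam) (t : ℕ) (i : Node) (k k' : N.Commodity) :
    Integrable (fun ω => Q t ω i k * (a t ω i k' - lam i k')) P ∧
      ∫ ω, Q t ω i k * (a t ω i k' - lam i k') ∂P = 0 := by
  have hQ := hr.memLp_backlog hA t i k
  have ha : MemLp (fun ω => a t ω i k' - lam i k') 2 P := (hA.memLp_two t i k').sub (memLp_const _)
  refine ⟨hQ.integrable_mul ha, ?_⟩
  have hind : IndepFun (Q t) (a t) P := by
    rw [IndepFun_iff_Indep]
    exact indep_of_indep_of_le_left (hA.indep_past t).symm (hr.adapted t).comap_le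
  have hcomp : IndepFun (fun ω => Q t ω i k) (fun ω => a t ω i k' - lam i k') P :=
    hind.comp (φ := fun v : N.Vec => v i k) (ψ := fun v : N.Vec => v i k' - lam i k')
      ((measurable_pi_apply k).comp (measurable_pi_apply i))
      (((measurable_pi_apply k').comp (measurable_pi_apply i)).sub_const _)
  rw [hcomp.integral_fun_mul_eq_mul_integral hQ.1 ha.1,
    integral_sub (hA.integrable t i k') (integrable_const _), hA.mean]
  simp

theorem integral_backlog_joins (hr : N.IsMaxWeightRun P ℱ a V Q x y)
    (hA : N.IsIIDArrivals P ℱ a lam) (t : ℕ) :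
    Integrable (fun ω => ∑ i, ∑ k, Q t ω i k * (N.joins (a t ω) i k - N.joins lam i k)) P ∧
      ∫ ω, ∑ i, ∑ k, Q t ω i k * (N.joins (a t ω) i k - N.joins lam i k) ∂P = 0 := by
  have hexp : ∀ ω i k, Q t ω i k * (N.joins (a t ω) i k - N.joins lam i k) =
      ∑ k' : N.Commodity, if k'.1 = k.1 ∧ N.residual i k' = k.2.1 then
        Q t ω i k * (a t ω i k' - lam i k') else 0 := by
    intro ω i k
    simp only [joins, ← Finset.sum_sub_distrib, Finset.mul_sum]
    refine Finset.sum_congr rfl fun k' _ => ?_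
    split_ifs <;> simp
  have hint : ∀ i (k k' : N.Commodity), Integrable (fun ω =>
      if k'.1 = k.1 ∧ N.residual i k' = k.2.1 then
        Q t ω i k * (a t ω i k' - lam i k') else 0) P ∧
      ∫ ω, (if k'.1 = k.1 ∧ N.residual i k' = k.2.1 then
        Q t ω i k * (a t ω i k' - lam i k') else 0) ∂P = 0 := by
    intro i k k'
    split_ifs
    exacts [hr.integral_backlog_mul hA t i k k', ⟨integrable_zero _ _ _, integral_zero _ _⟩]
  simp only [hexp]
  have h1 : ∀ i k, Integrable (fun ω => ∑ k' : N.Commodity,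
      if k'.1 = k.1 ∧ N.residual i k' = k.2.1 then
        Q t ω i k * (a t ω i k' - lam i k') else 0) P :=
    fun i k => integrable_finsetSum _ fun k' _ => (hint i k k').1
  have h2 := fun i => integrable_finsetSum Finset.univ fun k _ => h1 i k
  refine ⟨integrable_finsetSum _ fun i _ => h2 i, ?_⟩
  rw [integral_finsetSum _ fun i _ => h2 i]
  refine Finset.sum_eq_zero fun i _ => ?_
  rw [integral_finsetSum _ fun k _ => h1 i k]
  refine Finset.sum_eq_zero fun k _ => ?_
  rw [integral_finsetSum _ fun k' _ => (hint i k k').1]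
  exact Finset.sum_eq_zero fun k' _ => (hint i k k').2

/-- The expectation of the backlogs grows at least by the difference of the mean flows. -/
theorem integral_backlog_succ_ge (hr : N.IsMaxWeightRun P ℱ a V Q x y)
    (hA : N.IsIIDArrivals P ℱ a lam) (t : ℕ) {i : Node} {k : N.Commodity}
    (hk : ¬ N.Consumed i k) :
    N.joins (N.inflow (meanDecision P (y t))) i k + N.joins lam i k ≤
      N.outflow (meanDecision P (y t)) i k +
        (∫ ω, Q (t + 1) ω i k ∂P - ∫ ω, Q t ω i k ∂P) := by
  have ho := (nonnegForm_outflow i k).integral (P := P) (hr.meas_y_proc t) (hr.meas_y_trans t)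
    (hr.feasible_operated t)
  have hj := (nonnegForm_joins_inflow i k).integral (P := P) (hr.meas_y_proc t)
    (hr.meas_y_trans t) (hr.feasible_operated t)
  have ha := (hA.memLp_joins t i k).integrable one_le_two
  have hQ := hr.integrable_backlog hA t i k
  have hQ' := hr.integrable_backlog hA (t + 1) i k
  have hsub : Integrable (fun ω => Q (t + 1) ω i k - Q t ω i k) P := hQ'.sub hQ
  have hmono : ∫ ω, (N.joins (N.inflow (y t ω)) i k + N.joins (a t ω) i k) ∂P ≤
      ∫ ω, (N.outflow (y t ω) i k + (Q (t + 1) ω i k - Q t ω i k)) ∂P := by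
    refine integral_mono (hj.1.add ha) (ho.1.add hsub) fun ω => ?_
    have hs := hr.served t ω i k
    have hm : max (Q t ω i k - N.outflow (x t ω) i k) 0 =
        Q t ω i k - min (Q t ω i k) (N.outflow (x t ω) i k) := by
      rcases le_total (Q t ω i k) (N.outflow (x t ω) i k) with h | h
      · rw [max_eq_right (by linarith), min_eq_left h, sub_self]
      · rw [max_eq_left (by linarith), min_eq_right h]
    have hstep := hr.step t ω i k hk
    rw [joins_add (N.inflow (y t ω)) (a t ω), hm] at hstep
    simp only
    linarith
  rw [integral_add hj.1 ha, integral_add ho.1 hsub, integral_sub hQ' hQ, ho.2, hj.2,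
    hA.integral_joins] at hmono
  exact hmono

end IsMaxWeightRun

/-- The drift-plus-penalty inequality in expectation. The constant depends on the network and the
bound on the second moments only. -/
theorem exists_drift_bound (N : CloudNetwork Node Srv) (A : ℝ) :
    ∃ B : ℝ, 0 ≤ B ∧ ∀ {Ω : Type*} [m : MeasurableSpace Ω] (P : Measure Ω)
      [IsProbabilityMeasure P] (ℱ : Filtration ℕ m) (a : ℕ → Ω → N.Vec) (lam : N.Vec),
      N.IsIIDArrivals P ℱ a lam → (∀ i k, ∫ ω, (a 0 ω i k) ^ 2 ∂P ≤ A) →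
      ∀ (V : ℝ) (Q : ℕ → Ω → N.Vec) (x y : ℕ → Ω → N.Decision), 0 ≤ V →
      N.IsMaxWeightRun P ℱ a V Q x y →
      ∀ (ε : ℝ), 0 ≤ ε → ∀ z : N.Decision, Supports z (fun i k => lam i k + ε) → ∀ t,
        ∫ ω, sqBacklog (Q (t + 1) ω) ∂P + 2 * V * ∫ ω, N.cost (x t ω) ∂P +
            2 * ε * ∫ ω, N.totalBacklog (Q t ω) ∂P ≤
          ∫ ω, sqBacklog (Q t ω) ∂P + 2 * V * N.cost z + 2 * B := by
  obtain ⟨K, hK, hKb⟩ := exists_flow_bound N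
  set S : ℝ := ∑ _i : Node, ∑ _k : N.Commodity,
    2 * (Fintype.card N.Commodity * ∑ _k' : N.Commodity, |A|)
  refine ⟨(K + S) / 2, by positivity, ?_⟩
  intro Ω m P _ ℱ a lam hA h2 V Q x y hV hr ε hε z hz t
  have hmu : ∀ i k, 0 ≤ lam i k + ε := fun i k => add_nonneg (hA.rate_nonneg i k) hε
  have hpath : ∀ ω, sqBacklog (Q (t + 1) ω) + 2 * V * N.cost (x t ω) +
      2 * ε * N.totalBacklog (Q t ω) ≤
      sqBacklog (Q t ω) + (2 * V * N.cost z + K) +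
      ∑ i, ∑ _k : N.Commodity, 2 * (Fintype.card N.Commodity * ∑ k', a t ω i k' ^ 2) +
      2 * ∑ i, ∑ k, Q t ω i k * (N.joins (a t ω) i k - N.joins lam i k) := by
    intro ω
    have h1 := hr.sqBacklog_step_le hA.nonneg hV hmu hz t ω
    have h3 := hKb _ (hr.feasible t ω) (a t ω)
    -- Every queue that is not of destination state receives at least its own slack `ε`.
    have h4 : (∑ i, ∑ k, Q t ω i k *
        (N.joins (a t ω) i k - N.joins (fun i k => lam i k + ε) i k)) ≤
        (∑ i, ∑ k, Q t ω i k * (N.joins (a t ω) i k - N.joins lam i k)) -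
          ε * N.totalBacklog (Q t ω) := by
      simp only [totalBacklog, Finset.mul_sum, ← Finset.sum_sub_distrib]
      refine Finset.sum_le_sum fun i _ => Finset.sum_le_sum fun k _ => ?_
      have h0 := hr.backlog_nonneg hA.nonneg t ω i k
      rw [joins_add lam (fun _ _ => ε), abs_of_nonneg h0]
      by_cases hk : N.Consumed i k
      · simp [hr.consumed t ω i k hk]
      · have := mul_le_mul_of_nonneg_left (le_joins (A := fun _ _ => ε) (fun _ => hε) hk) h0
        linarith
    linarith
  have iQ := hr.integrable_sqBacklog hA t
  have iQ' := hr.integrable_sqBacklog hA (t + 1)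
  have ic := (hr.integrable_cost t).const_mul (2 * V)
  have iT := (hr.integrable_totalBacklog hA t).const_mul (2 * ε)
  have isq : ∀ i k, Integrable (fun ω => a t ω i k ^ 2) P :=
    fun i k => (hA.memLp_two t i k).integrable_sq
  have isum : ∀ i, Integrable (fun ω =>
      2 * ((Fintype.card N.Commodity : ℝ) * ∑ k', a t ω i k' ^ 2)) P :=
    fun i => ((integrable_finsetSum _ fun k _ => isq i k).const_mul _).const_mul _
  have isum2 : ∀ i, Integrable (fun ω => ∑ _k : N.Commodity,
      2 * ((Fintype.card N.Commodity : ℝ) * ∑ k', a t ω i k' ^ 2)) P :=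
    fun i => integrable_finsetSum _ fun _ _ => isum i
  have iG : Integrable (fun ω => ∑ i, ∑ _k : N.Commodity,
      2 * ((Fintype.card N.Commodity : ℝ) * ∑ k', a t ω i k' ^ 2)) P :=
    integrable_finsetSum _ fun i _ => isum2 i
  have hG : ∫ ω, (∑ i, ∑ _k : N.Commodity,
      2 * ((Fintype.card N.Commodity : ℝ) * ∑ k', a t ω i k' ^ 2)) ∂P ≤ S := by
    rw [integral_finsetSum _ fun i _ => isum2 i]
    refine Finset.sum_le_sum fun i _ => ?_
    rw [integral_finsetSum _ fun _ _ => isum i]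
    refine Finset.sum_le_sum fun _ _ => ?_
    rw [integral_const_mul, integral_const_mul, integral_finsetSum _ fun k _ => isq i k]
    gcongr with k _
    exact (hA.sq_le h2 t i k).trans (le_abs_self A)
  obtain ⟨iD, hD⟩ := hr.integral_backlog_joins hA t
  have il : Integrable (fun ω => sqBacklog (Q (t + 1) ω) + 2 * V * N.cost (x t ω)) P := iQ'.add ic
  have ir : Integrable (fun ω => sqBacklog (Q t ω) + (2 * V * N.cost z + K)) P :=
    iQ.add (integrable_const _)
  have ir' : Integrable (fun ω => sqBacklog (Q t ω) + (2 * V * N.cost z + K) +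
      ∑ i, ∑ _k : N.Commodity, 2 * ((Fintype.card N.Commodity : ℝ) * ∑ k', a t ω i k' ^ 2)) P :=
    ir.add iG
  have hmono := integral_mono (il.add iT) (ir'.add (iD.const_mul 2)) hpath
  simp only [Pi.add_apply] at hmono
  rw [integral_add il iT, integral_add iQ' ic, integral_const_mul, integral_const_mul,
    integral_add ir' (iD.const_mul 2), integral_add ir iG, integral_add iQ (integrable_const _),
    integral_const_mul, hD, integral_const, probReal_univ, one_smul] at hmono
  linarith

end Run

/-! ### Time averages and limit points of decisions -/

theorem timeAvg_add (u v : ℕ → ℝ) (T : ℕ) :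
    timeAvg (fun t => u t + v t) T = timeAvg u T + timeAvg v T := by
  simp only [timeAvg, Finset.sum_add_distrib, mul_add]

theorem timeAvg_const_mul (c : ℝ) (u : ℕ → ℝ) (T : ℕ) :
    timeAvg (fun t => c * u t) T = c * timeAvg u T := by
  simp only [timeAvg, ← Finset.mul_sum]
  ring

theorem timeAvg_mono {u v : ℕ → ℝ} (h : ∀ t, u t ≤ v t) (T : ℕ) : timeAvg u T ≤ timeAvg v T :=
  mul_le_mul_of_nonneg_left (Finset.sum_le_sum fun t _ => h t) (by positivity)

theorem timeAvg_nonneg {u : ℕ → ℝ} (h : ∀ t, 0 ≤ u t) (T : ℕ) : 0 ≤ timeAvg u T :=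
  mul_nonneg (by positivity) (Finset.sum_nonneg fun t _ => h t)

theorem timeAvg_const (c : ℝ) {T : ℕ} (hT : 1 ≤ T) : timeAvg (fun _ => c) T = c := by
  have : (T : ℝ) ≠ 0 := by positivity
  simp only [timeAvg, Finset.sum_const, Nat.card_Icc, Nat.add_sub_cancel, nsmul_eq_mul]
  field_simp

theorem timeAvg_le {u : ℕ → ℝ} {c : ℝ} (hc : 0 ≤ c) (h : ∀ t, u t ≤ c) (T : ℕ) :
    timeAvg u T ≤ c := by
  rcases Nat.eq_zero_or_pos T with rfl | hT
  · simpa [timeAvg] using hc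
  · exact (timeAvg_mono h T).trans_eq (timeAvg_const c hT)

theorem timeAvg_sub_succ (u : ℕ → ℝ) (T : ℕ) :
    timeAvg (fun t => u (t + 1) - u t) T = (u (T + 1) - u 1) / T := by
  have : ∑ t ∈ Finset.Icc 1 T, (u (t + 1) - u t) = u (T + 1) - u 1 := by
    induction T with
    | zero => simp
    | succ T ih =>
      rw [Finset.sum_Icc_succ_top (by omega), ih]
      ring
  rw [timeAvg, this]
  ring

theorem hasAvg_const (c : ℝ) : HasAvg (fun _ => c) c :=
  tendsto_const_nhds.congr' <| (eventually_ge_atTop 1).mono fun _ hT => (timeAvg_const c hT).symm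

theorem upperAvg_le {u : ℕ → ℝ} {c : ℝ} (h : ∀ δ > 0, ∀ᶠ T in atTop, timeAvg u T ≤ c + δ) :
    upperAvg u ≤ (c : EReal) := by
  refine EReal.le_of_forall_lt_iff_le.1 fun z hz => ?_
  have hz' : c < z := EReal.coe_lt_coe_iff.1 hz
  refine limsup_le_of_le (by isBoundedDefault) ?_
  filter_upwards [h (z - c) (sub_pos.2 hz')] with T hT
  exact EReal.coe_le_coe_iff.2 (by linarith)

/-- The entrywise time average of a sequence of decisions. -/
noncomputable def avgDecision (d : ℕ → N.Decision) (T : ℕ) : N.Decision :=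
  ⟨fun i o => timeAvg (fun t => (d t).proc i o) T, fun e o => timeAvg (fun t => (d t).trans e o) T⟩

omit [Fintype Node] [Fintype Srv] [DecidableEq Srv] in
theorem NonnegForm.timeAvg {F : N.Decision → ℝ} (hF : NonnegForm N F) (d : ℕ → N.Decision)
    (T : ℕ) : F (avgDecision d T) = CloudNetwork.timeAvg (fun t => F (d t)) T := by
  induction hF with
  | zero => simp [CloudNetwork.timeAvg]
  | proc i o => rfl
  | trans e o => rfl
  | add _ _ h1 h2 => simp only [timeAvg_add, h1, h2]
  | smul c _ _ h => simp only [timeAvg_const_mul, h]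

omit [DecidableEq Srv] in
theorem feasible_avgDecision {d : ℕ → N.Decision} (hd : ∀ t, N.Feasible (d t)) (T : ℕ) :
    N.Feasible (avgDecision d T) where
  proc_nonneg i o := timeAvg_nonneg (fun t => (hd t).proc_nonneg i o) T
  trans_nonneg e o := timeAvg_nonneg (fun t => (hd t).trans_nonneg e o) T
  proc_cap i := ((nonnegForm_work i).timeAvg d T).trans_le
    (timeAvg_le (N.procCap_nonneg i) (fun t => (hd t).proc_cap i) T)
  trans_cap e := ((nonnegForm_load e).timeAvg d T).trans_le
    (timeAvg_le (N.linkCap_nonneg e.1 e.2) (fun t => (hd t).trans_cap e) T)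

omit [DecidableEq Srv] in
/-- Sequential compactness of the set of feasible decisions. -/
theorem exists_feasible_limit {d : ℕ → N.Decision} (hd : ∀ n, N.Feasible (d n)) :
    ∃ z, N.Feasible z ∧ ∃ φ : ℕ → ℕ, StrictMono φ ∧ ∀ F, NonnegForm N F →
      Tendsto (fun n => F (d (φ n))) atTop (𝓝 (F z)) := by
  have hmem : ∀ n, ((d n).proc, (d n).trans) ∈ Set.Icc
      ((0, 0) : (Node → N.ProcOp → ℝ) × ({e : Node × Node // e ∈ N.links} → N.Op → ℝ))
      (fun i o => N.procCap i / o.work, fun e _ => N.linkCap e.1) := fun n =>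
    ⟨⟨fun i o => (hd n).proc_nonneg i o, fun e o => (hd n).trans_nonneg e o⟩,
      fun i o => (hd n).proc_le i o, fun e o => (hd n).trans_le e o⟩
  obtain ⟨z, -, φ, hφ, hz⟩ := isCompact_Icc.tendsto_subseq hmem
  have hzp := tendsto_pi_nhds.1 (hz.fst_nhds)
  have hzt := tendsto_pi_nhds.1 (hz.snd_nhds)
  have hF : ∀ F, NonnegForm N F → Tendsto (fun n => F (d (φ n))) atTop (𝓝 (F ⟨z.1, z.2⟩)) :=
    fun F h => h.tendsto (z := ⟨z.1, z.2⟩) (fun i o => tendsto_pi_nhds.1 (hzp i) o)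
      fun e o => tendsto_pi_nhds.1 (hzt e) o
  exact ⟨⟨z.1, z.2⟩,
    { proc_nonneg := fun i o => ge_of_tendsto' (hF _ (.proc i o)) fun n => (hd _).proc_nonneg i o
      trans_nonneg := fun e o =>
        ge_of_tendsto' (hF _ (.trans e o)) fun n => (hd _).trans_nonneg e o
      proc_cap := fun i => le_of_tendsto' (hF _ (nonnegForm_work i)) fun n => (hd _).proc_cap i
      trans_cap := fun e => le_of_tendsto' (hF _ (nonnegForm_load e)) fun n => (hd _).trans_cap e },
    φ, hφ, hF⟩

/-! ### The optimal cost is attained by stationary decisions -/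

theorem Supports.admissible {z : N.Decision} {lam : N.Vec} (h : Supports z lam) :
    N.Admissible lam fun _ => z :=
  ⟨fun _ => h.1, N.inflow z, N.outflow z, fun _ _ => hasAvg_const _, fun _ _ => hasAvg_const _, h.2⟩

/-- The averages of a policy have a limit point, which is a stationary decision with the same
long-term flows and cost. -/
theorem Admissible.exists_supports {lam : N.Vec} {f : ℕ → N.Decision} (hf : N.Admissible lam f) :
    ∃ z, Supports z lam ∧ ∀ h, HasAvg (fun t => N.cost (f t)) h → N.cost z = h := by
  obtain ⟨hfeas, fin, fout, hin, hout, hle⟩ := hf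
  obtain ⟨z, hz, φ, hφ, hF⟩ := exists_feasible_limit (feasible_avgDecision hfeas)
  have key : ∀ F, NonnegForm N F → ∀ l, HasAvg (fun t => F (f t)) l → F z = l := by
    intro F h l hl
    refine tendsto_nhds_unique (hF F h) ?_
    simp only [h.timeAvg]
    exact hl.comp hφ.tendsto_atTop
  refine ⟨z, ⟨hz, fun i k hk => ?_⟩, fun h => key _ nonnegForm_cost h⟩
  rw [show N.inflow z = fin from funext fun i => funext fun k =>
    key _ (nonnegForm_inflow i k) _ (hin i k), key _ (nonnegForm_outflow i k) _ (hout i k)]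
  exact hle i k hk

theorem Supports.optCost_le {z : N.Decision} {lam : N.Vec} (h : Supports z lam) :
    N.optCost lam ≤ N.cost z := by
  refine csInf_le ⟨0, ?_⟩ ⟨_, h.admissible, hasAvg_const _⟩
  rintro c ⟨f, hf, hc⟩
  exact ge_of_tendsto' hc fun T =>
    timeAvg_nonneg (fun t => (hf.1 t).nonneg_of_form nonnegForm_cost) T

theorem exists_supports_cost_lt {lam : N.Vec} (h : lam ∈ N.capacityRegion) {δ : ℝ} (hδ : 0 < δ) :
    ∃ z, Supports z lam ∧ N.cost z < N.optCost lam + δ := by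
  obtain ⟨f, hf⟩ := h
  obtain ⟨z, hz, -⟩ := hf.exists_supports
  obtain ⟨c, ⟨g, hg, hc⟩, hlt⟩ := exists_lt_of_csInf_lt
    (s := {h | ∃ f, N.Admissible lam f ∧ HasAvg (fun t => N.cost (f t)) h})
    ⟨_, _, hz.admissible, hasAvg_const _⟩ (lt_add_of_pos_right _ hδ)
  obtain ⟨z', hz', hcost⟩ := hg.exists_supports
  exact ⟨z', hz', (hcost c hc).trans_lt hlt⟩

/-! ### Long-term behaviour of a max-weight run -/

section Run

variable {Ω : Type*} [m : MeasurableSpace Ω] {P : Measure Ω} [IsProbabilityMeasure P]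
  {ℱ : Filtration ℕ m} {a : ℕ → Ω → N.Vec} {lam : N.Vec} {V : ℝ} {Q : ℕ → Ω → N.Vec}
  {x y : ℕ → Ω → N.Decision}

namespace IsMaxWeightRun

/-- If the second moments of the backlogs grow at most linearly, then the backlogs are mean rate
stable. -/
theorem tendsto_backlog_div (hr : N.IsMaxWeightRun P ℱ a V Q x y)
    (hA : N.IsIIDArrivals P ℱ a lam) {L D : ℝ}
    (hgrow : ∀ t : ℕ, ∫ ω, sqBacklog (Q t ω) ∂P ≤ L + D * t) (i : Node) (k : N.Commodity) :
    Tendsto (fun T : ℕ => (∫ ω, Q (T + 1) ω i k ∂P - ∫ ω, Q 1 ω i k ∂P) / T) atTop (𝓝 0) := by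
  have h1 : Tendsto (fun T : ℕ => (∫ ω, Q (T + 1) ω i k ∂P) / T) atTop (𝓝 0) := by
    have hlim : Tendsto (fun T : ℕ => (|L| + 2 * |D| + 1) / (2 * √(T : ℝ))) atTop (𝓝 0) :=
      tendsto_const_nhds.div_atTop
        ((Real.tendsto_sqrt_atTop.comp tendsto_natCast_atTop_atTop).const_mul_atTop two_pos)
    refine tendsto_of_tendsto_of_tendsto_of_le_of_le' tendsto_const_nhds hlim
      (Eventually.of_forall fun T => div_nonneg
        (integral_nonneg fun ω => hr.backlog_nonneg hA.nonneg _ ω i k) (Nat.cast_nonneg T)) ?_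
    filter_upwards [eventually_ge_atTop 1] with T hT
    have hT1 : (1 : ℝ) ≤ T := by exact_mod_cast hT
    have hs : 0 < √(T : ℝ) := Real.sqrt_pos.2 (by linarith)
    have hss : √(T : ℝ) * √(T : ℝ) = T := Real.mul_self_sqrt (by linarith)
    have hmono : ∫ ω, 2 * √(T : ℝ) * Q (T + 1) ω i k ∂P ≤
        ∫ ω, (sqBacklog (Q (T + 1) ω) + T) ∂P := by
      refine integral_mono ((hr.integrable_backlog hA _ i k).const_mul _)
        ((hr.integrable_sqBacklog hA _).add (integrable_const _)) fun ω => ?_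
      have hle : Q (T + 1) ω i k ^ 2 ≤ sqBacklog (Q (T + 1) ω) :=
        (Finset.single_le_sum (f := fun k => Q (T + 1) ω i k ^ 2) (fun k _ => sq_nonneg _)
          (Finset.mem_univ k)).trans
        (Finset.single_le_sum (f := fun i => ∑ k, Q (T + 1) ω i k ^ 2)
          (fun i _ => Finset.sum_nonneg fun k _ => sq_nonneg _) (Finset.mem_univ i))
      simp only
      nlinarith [sq_nonneg (Q (T + 1) ω i k - √(T : ℝ))]
    rw [integral_const_mul, integral_add (hr.integrable_sqBacklog hA _) (integrable_const _),
      integral_const, probReal_univ, one_smul] at hmono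
    have hg := hgrow (T + 1)
    push_cast at hg
    have hL : L ≤ |L| * T := (le_abs_self L).trans (le_mul_of_one_le_right (abs_nonneg L) hT1)
    have hD : D * (T + 1) ≤ 2 * |D| * T := by nlinarith [le_abs_self D, abs_nonneg D]
    rw [div_le_div_iff₀ (by linarith) (by positivity)]
    linarith
  have h2 := h1.sub (tendsto_const_div_atTop_nhds_zero_nat (∫ ω, Q 1 ω i k ∂P))
  simpa only [sub_div, sub_zero] using h2

/-- If the backlogs are mean rate stable, then the flows that are actually operated support the
arrival rates in the long term, so that the costs cannot stay below the optimal cost. -/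
theorem eventually_optCost_le (hr : N.IsMaxWeightRun P ℱ a V Q x y)
    (hA : N.IsIIDArrivals P ℱ a lam)
    (hstab : ∀ i k, Tendsto (fun T : ℕ =>
      (∫ ω, Q (T + 1) ω i k ∂P - ∫ ω, Q 1 ω i k ∂P) / T) atTop (𝓝 0)) {δ : ℝ} (hδ : 0 < δ) :
    ∀ᶠ T in atTop, N.optCost lam - δ ≤ timeAvg (fun t => ∫ ω, N.cost (x t ω) ∂P) T := by
  by_contra hcon
  obtain ⟨φ, hφ, hlt⟩ := extraction_of_frequently_atTop (not_eventually.1 hcon)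
  set d : ℕ → N.Decision := fun t => meanDecision P (y t)
  have hd : ∀ t, N.Feasible (d t) := fun t =>
    feasible_meanDecision (hr.meas_y_proc t) (hr.meas_y_trans t) (hr.feasible_operated t)
  obtain ⟨z, hz, ψ, hψ, hF⟩ := exists_feasible_limit fun n => feasible_avgDecision hd (φ n)
  have hsub : Tendsto (fun n => φ (ψ n)) atTop atTop := hφ.tendsto_atTop.comp hψ.tendsto_atTop
  have hsup : Supports z lam := by
    refine ⟨hz, fun i k hk => ?_⟩
    rw [joins_add (N.inflow z) lam]
    have hlim := (hF _ (nonnegForm_outflow i k)).add ((hstab i k).comp hsub)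
    rw [add_zero] at hlim
    refine le_of_tendsto_of_tendsto ((hF _ (nonnegForm_joins_inflow i k)).add_const _) hlim ?_
    filter_upwards [hsub.eventually_ge_atTop 1] with n hn
    have h := timeAvg_mono (fun t => hr.integral_backlog_succ_ge hA t hk) (φ (ψ n))
    rw [timeAvg_add, timeAvg_add, timeAvg_const _ hn,
      timeAvg_sub_succ (fun t => ∫ ω, Q t ω i k ∂P)] at h
    rw [(nonnegForm_joins_inflow i k).timeAvg, (nonnegForm_outflow i k).timeAvg]
    exact h
  have hcost : N.cost z ≤ N.optCost lam - δ := by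
    refine le_of_tendsto' (hF _ nonnegForm_cost) fun n => ?_
    refine le_trans ?_ (not_le.1 (hlt (ψ n))).le
    rw [nonnegForm_cost.timeAvg]
    refine timeAvg_mono (fun t => ?_) _
    have hy := nonnegForm_cost.integral (P := P) (hr.meas_y_proc t) (hr.meas_y_trans t)
      (hr.feasible_operated t)
    rw [← hy.2]
    exact integral_mono hy.1 (hr.integrable_cost t) fun ω => hr.form_le nonnegForm_cost t ω
  linarith [hsup.optCost_le]

end IsMaxWeightRun

end Run

end CloudNetwork

/-! ### The performance bounds -/

open CloudNetwork

theorem theorem2 {Node Srv : Type*} [Fintype Node] [DecidableEq Node]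
    [Fintype Srv] [DecidableEq Srv] (N : CloudNetwork Node Srv) (A : ℝ) :
    ∃ B : ℝ, 0 ≤ B ∧
      ∀ {Ω : Type*} [m : MeasurableSpace Ω] (P : Measure Ω) [IsProbabilityMeasure P]
        (ℱ : Filtration ℕ m) (a : ℕ → Ω → N.Vec) (lam : N.Vec),
        N.IsIIDArrivals P ℱ a lam →
        (∀ i k, ∫ ω, (a 0 ω i k) ^ 2 ∂P ≤ A) →
        lam ∈ interior N.capacityRegion →
        ∀ (V : ℝ) (Q : ℕ → Ω → N.Vec) (x y : ℕ → Ω → N.Decision), 0 ≤ V →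
          N.IsMaxWeightRun P ℱ a V Q x y →
          (∀ t, Integrable (fun ω => N.totalBacklog (Q t ω)) P) ∧
          (∀ t, Integrable (fun ω => N.cost (x t ω)) P) ∧
          (∀ ε : ℝ, 0 < ε → (fun i k => lam i k + ε) ∈ N.capacityRegion →
            CloudNetwork.upperAvg (fun t => ∫ ω, N.totalBacklog (Q t ω) ∂P) ≤
              ((B / ε + ((N.optCost (fun i k => lam i k + ε) - N.optCost lam) / ε) * V : ℝ) :
                EReal)) ∧
          CloudNetwork.upperAvg (fun t => ∫ ω, N.totalBacklog (Q t ω) ∂P) < ⊤ ∧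
          (0 < V →
            CloudNetwork.upperAvg (fun t => ∫ ω, N.cost (x t ω) ∂P) ≤
              ((N.optCost lam + B / V : ℝ) : EReal)) := by
  obtain ⟨B, hB, hbound⟩ := exists_drift_bound N A
  refine ⟨B, hB, ?_⟩
  intro Ω m P _ ℱ a lam hA h2 hlam V Q x y hV hr
  have hdrift := hbound P ℱ a lam hA h2 V Q x y hV hr
  set L : ℕ → ℝ := fun t => ∫ ω, sqBacklog (Q t ω) ∂P
  set q : ℕ → ℝ := fun t => ∫ ω, N.totalBacklog (Q t ω) ∂P
  set h : ℕ → ℝ := fun t => ∫ ω, N.cost (x t ω) ∂P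
  have hL0 : ∀ t, 0 ≤ L t := fun t => integral_nonneg fun ω =>
    Finset.sum_nonneg fun i _ => Finset.sum_nonneg fun k _ => sq_nonneg _
  have hh0 : ∀ t, 0 ≤ h t := fun t => integral_nonneg fun ω =>
    (hr.feasible t ω).nonneg_of_form nonnegForm_cost
  have hmem : lam ∈ N.capacityRegion := interior_subset hlam
  have hself : (fun i k => lam i k + (0 : ℝ)) = lam := by simp
  -- The averaged drift inequality, with the initial state contributing `L 1 / T`.
  have havg : ∀ ε : ℝ, 0 ≤ ε → ∀ z : N.Decision, Supports z (fun i k => lam i k + ε) →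
      ∀ T : ℕ, 1 ≤ T →
        2 * V * timeAvg h T + 2 * ε * timeAvg q T ≤ 2 * V * N.cost z + 2 * B + L 1 / T := by
    intro ε hε z hz T hT
    have h1 := timeAvg_mono (u := fun t => (L (t + 1) - L t) + (2 * V * h t + 2 * ε * q t))
      (v := fun _ => 2 * V * N.cost z + 2 * B)
      (fun t => by linarith [hdrift ε hε z hz t]) T
    rw [timeAvg_const _ hT, timeAvg_add, timeAvg_add, timeAvg_sub_succ, timeAvg_const_mul,
      timeAvg_const_mul, sub_div] at h1
    have h3 : 0 ≤ L (T + 1) / T := div_nonneg (hL0 _) (Nat.cast_nonneg T)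
    linarith
  have hstab : ∀ i k, Tendsto (fun T : ℕ =>
      (∫ ω, Q (T + 1) ω i k ∂P - ∫ ω, Q 1 ω i k ∂P) / T) atTop (𝓝 0) := by
    intro i k
    obtain ⟨z, hz, -⟩ := exists_supports_cost_lt hmem one_pos
    rw [← hself] at hz
    refine hr.tendsto_backlog_div hA (L := L 0) (D := 2 * V * N.cost z + 2 * B) (fun t => ?_) i k
    change L t ≤ _
    induction t with
    | zero => simp
    | succ t ih =>
      have h1 := hdrift 0 le_rfl z hz t
      have h3 := mul_nonneg (mul_nonneg zero_le_two hV) (hh0 t)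
      push_cast
      linarith
  have hL1 : ∀ η > 0, ∀ᶠ T : ℕ in atTop, L 1 / T ≤ η := fun η hη =>
    (tendsto_const_div_atTop_nhds_zero_nat (L 1)).eventually_le_const hη
  have hbacklog : ∀ ε : ℝ, 0 < ε → (fun i k => lam i k + ε) ∈ N.capacityRegion →
      upperAvg q ≤
        ((B / ε + ((N.optCost (fun i k => lam i k + ε) - N.optCost lam) / ε) * V : ℝ) : EReal) := by
    intro ε hε hmemε
    refine upperAvg_le fun δ hδ => ?_
    have hη : 0 < δ * ε / (2 * V + 1) := by positivity
    obtain ⟨z, hz, hcost⟩ := exists_supports_cost_lt hmemε hη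
    filter_upwards [eventually_ge_atTop 1, hr.eventually_optCost_le hA hstab hη, hL1 _ hη]
      with T hT hlow hini
    have hmain := havg ε hε.le z hz T hT
    have hηeq : (2 * V + 1) * (δ * ε / (2 * V + 1)) = δ * ε := by field_simp
    have h1 := mul_le_mul_of_nonneg_left hcost.le hV
    have h3 := mul_le_mul_of_nonneg_left hlow hV
    have hgoal : ε * timeAvg q T ≤
        B + (N.optCost (fun i k => lam i k + ε) - N.optCost lam) * V + δ * ε := by
      linarith
    have hrw : B / ε + ((N.optCost (fun i k => lam i k + ε) - N.optCost lam) / ε) * V + δ =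
        (B + (N.optCost (fun i k => lam i k + ε) - N.optCost lam) * V + δ * ε) / ε := by
      field_simp
    rw [hrw, le_div_iff₀ hε]
    linarith
  refine ⟨hr.integrable_totalBacklog hA, hr.integrable_cost, hbacklog, ?_, fun hVpos => ?_⟩
  · have hcont : Continuous fun ε : ℝ => (fun i k => lam i k + ε : N.Vec) := by fun_prop
    have hev : ∀ᶠ ε in 𝓝 (0 : ℝ), (fun i k => lam i k + ε : N.Vec) ∈ N.capacityRegion := by
      refine hcont.continuousAt.eventually_mem ?_
      rw [hself]
      exact mem_interior_iff_mem_nhds.1 hlam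
    obtain ⟨ε, hmemε, hε⟩ :=
      ((hev.filter_mono nhdsWithin_le_nhds).and (self_mem_nhdsWithin (s := Set.Ioi 0))).exists
    exact (hbacklog ε hε hmemε).trans_lt (EReal.coe_lt_top _)
  · refine upperAvg_le fun δ hδ => ?_
    obtain ⟨z, hz, hcost⟩ := exists_supports_cost_lt hmem (half_pos hδ)
    rw [← hself] at hz
    filter_upwards [eventually_ge_atTop 1, hL1 (V * δ) (by positivity)] with T hT hini
    have hmain := havg 0 le_rfl z hz T hT
    have h1 := mul_le_mul_of_nonneg_left hcost.le hV
    have hgoal : V * timeAvg h T ≤ V * N.optCost lam + B + V * δ := by linarith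
    have hrw : N.optCost lam + B / V + δ = (V * N.optCost lam + B + V * δ) / V := by field_simp
    rw [hrw, le_div_iff₀ hVpos]
    linarith
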